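/- Let $H$ be a complex Hilbert space with scalar product $\langle\cdot,\cdot\rangle$ (linear in the first argument), and let $A$ be a (densely defined, possibly unbounded) self-adjoint operator in $H$ with simple discrete spectrum, i.e. every point of $\sigma(A)$ is an isolated point of $\sigma(A)$ and an eigenvalue of $A$ with one-dimensional eigenspace. Let $(\lambda_n)_{n\in I}$ be an enumeration of $\sigma(A)\subset\mathbb{R}$ by an index set $I$, and assume that it is $d$-separated for some $d>0$: $|\lambda_m-\lambda_n|\ge d$ for all $m\neq n$ in $I$. Let $\varphi,\psi\in H$ and let $B=A+\langle\cdot,\varphi\rangle\psi$ on the domain $\operatorname{dom}(B)=\operatorname{dom}(A)$. For $\mu\in\mathbb{C}$, the algebraic multiplicity of $\mu$ as an eigenvalue of $B$ is the dimension of the root subspace $\{y : (B-\mu)^k y=0 \text{ for some } k\in\mathbb{N}\}$, where $(B-\mu)^k$ is taken on its natural domain. Then the eigenvalues of $B$ can be labelled as $\mu_n\in\mathbb{C}$, $n\in I$, counting with algebraic multiplicity (that is, for every $z\in\mathbb{C}$ the number of $n\in I$ with $\mu_n=z$ is equal to the algebraic multiplicity of $z$, which is $0$ if $z$ is not an eigenvalue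 of $B$), in such a way that $$\sum_{n\in I}|\mu_n-\lambda_n|<\infty .$$ In particular, all but finitely many eigenvalues of $B$ are simple, i.e. have algebraic multiplicity $1$. -/

import Mathlib

namespace RankOnePert

variable {H : Type*} [NormedAddCommGroup H] [InnerProductSpace ℂ H]

/-- `z` belongs to the resolvent set of the (unbounded) operator `T`: the map
`T - z : dom T → H` has a bounded everywhere defined two-sided inverse `R`. -/
def IsResolventPoint (T : H →ₗ.[ℂ] H) (z : ℂ) : Prop :=
  ∃ R : H →L[ℂ] H,
    (∀ y : H, ∃ h : R y ∈ T.domain, T ⟨R y, h⟩ - z • R y = y) ∧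
      ∀ x : T.domain, R (T x - z • (x : H)) = x

/-- The spectrum of `T`, the complement of the resolvent set. -/
def opSpectrum (T : H →ₗ.[ℂ] H) : Set ℂ := {z | ¬ IsResolventPoint T z}

/-- The null-space of `(T - z) ^ k`, on its natural domain:
`ker (T - z) ^ (k + 1) = {x ∈ dom T | (T - z) x ∈ ker (T - z) ^ k}`. -/
def kerPow (T : H →ₗ.[ℂ] H) (z : ℂ) : ℕ → Submodule ℂ H
  | 0 => ⊥
  | k + 1 => ((kerPow T z k).comap (T.toFun - z • T.domain.subtype)).map T.domain.subtype

theorem mem_kerPow_succ (T : H →ₗ.[ℂ] H) (z : ℂ) (k : ℕ) (x : H) :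
    x ∈ kerPow T z (k + 1) ↔ ∃ h : x ∈ T.domain, T ⟨x, h⟩ - z • x ∈ kerPow T z k := by
  simp [kerPow]

/-- The null-space of `T - z`. -/
def eigenspace (T : H →ₗ.[ℂ] H) (z : ℂ) : Submodule ℂ H := kerPow T z 1

theorem mem_eigenspace (T : H →ₗ.[ℂ] H) (z : ℂ) (x : H) :
    x ∈ eigenspace T z ↔ ∃ h : x ∈ T.domain, T ⟨x, h⟩ = z • x := by
  simp only [eigenspace, mem_kerPow_succ]
  simp [kerPow, sub_eq_zero]

/-- `z` is an eigenvalue of `T`. -/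
def IsEigenvalue (T : H →ₗ.[ℂ] H) (z : ℂ) : Prop := eigenspace T z ≠ ⊥

theorem kerPow_mono (T : H →ₗ.[ℂ] H) (z : ℂ) : Monotone (kerPow T z) := by
  refine monotone_nat_of_le_succ fun n => ?_
  induction n with
  | zero => exact bot_le
  | succ n ih =>
    intro x hx
    rw [mem_kerPow_succ] at hx ⊢
    exact ⟨hx.1, ih hx.2⟩

/-- The root subspace of `T` at `z`: all `x` with `(T - z) ^ k x = 0` for some `k`. -/
def rootSubspace (T : H →ₗ.[ℂ] H) (z : ℂ) : Submodule ℂ H := ⨆ k, kerPow T z k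

theorem mem_rootSubspace (T : H →ₗ.[ℂ] H) (z : ℂ) (x : H) :
    x ∈ rootSubspace T z ↔ ∃ k, x ∈ kerPow T z k :=
  Submodule.mem_iSup_of_directed _ (kerPow_mono T z).directed_le

/-- The algebraic multiplicity of `z`: the dimension of the root subspace, possibly `⊤`
(and `0` exactly when `z` is not an eigenvalue). -/
noncomputable def algMult (T : H →ₗ.[ℂ] H) (z : ℂ) : ℕ∞ :=
  Cardinal.toENat (Module.rank ℂ (rootSubspace T z))

/-- The spectrum of `T` consists of isolated points, each of them an eigenvalue with a
one-dimensional eigenspace. (This is used for self-adjoint `T`, for which the root subspaces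
are the eigenspaces.) -/
structure HasSimpleDiscreteSpectrum (T : H →ₗ.[ℂ] H) : Prop where
  isolated : ∀ z ∈ opSpectrum T, ∃ ε > 0, ∀ w ∈ opSpectrum T, w ≠ z → ε ≤ dist w z
  simple : ∀ z ∈ opSpectrum T, Module.finrank ℂ (eigenspace T z) = 1

/-- The operator `A + ⟨·, φ⟩ ψ` with the domain of `A`; the scalar product `⟨x, φ⟩`, linear
in `x`, is `inner ℂ φ x` in Mathlib's convention. -/
noncomputable def perturb (A : H →ₗ.[ℂ] H) (φ ψ : H) : H →ₗ.[ℂ] H where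
  domain := A.domain
  toFun := A.toFun + (InnerProductSpace.rankOne ℂ ψ φ).toLinearMap.comp A.domain.subtype

theorem perturb_apply (A : H →ₗ.[ℂ] H) (φ ψ : H) (x : A.domain) :
    perturb A φ ψ x = A x + inner ℂ φ (x : H) • ψ := rfl

end RankOnePert

/-!
The operator `A` is diagonal in an orthonormal basis `b` of eigenvectors (`exists_isDiagonal`): for
a real `t` off the spectrum, `(A - t)⁻¹` is bounded and self-adjoint with isolated nonzero spectrum,
so the continuous functional calculus shows that its eigenvectors span a dense subspace.

The perturbation is controlled by the characteristic function
`F(w) = 1 + ⟨(A - w)⁻¹ ψ, φ⟩ = 1 + ∑ c_i / (lam_i - w)`, where `c_i = ⟨b_i, φ⟩ ⟨ψ, b_i⟩` is summable.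
By the Weinstein-Aronszajn formula (`exists_algMult_eq`), the algebraic multiplicity of `z` for `B`
is the order of `F` at `z`, plus one if `z` is an eigenvalue of `A`. Its proof exhibits a power
series `u(w)` of vectors with `(B - w) u(w) = f(w) η`, where `f` has the right order at `z`; its
Taylor coefficients form a Jordan chain which exhausts the root subspace, up to one further
eigenvector when `φ` and `ψ` are both orthogonal to the eigenvector of `A` at `z`
(`rank_rootSubspace_inf_ker`).

Far from the origin and away from the `lam_i`, the function `F` is close to `1`. Hence, on a large
circle and on a small circle around each `lam_n` outside it, Rouché's theorem
(`exists_sum_order_eq_zero`) applies, and inside each of these circles `B` has as many eigenvalues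
as `A`. There are none elsewhere. This gives the labelling, with exactly one simple eigenvalue
`μ_n` near `lam_n` for all but finitely many `n`. From `F(μ_n) = 0`, where all summands but
the `n`-th contribute little, it follows that `|μ_n - lam_n| ≤ 2 |c_n|`, which is summable.
-/

open Set Filter Topology

namespace RankOnePert

/-! ### Diagonalisation of the self-adjoint operator -/

section Diagonalisation

variable {H : Type*} [NormedAddCommGroup H] [InnerProductSpace ℂ H]

/-- `T` is the maximal operator of multiplication by `lam` in the coordinates of the orthonormal
basis `b`: `T x = y` (with `x` in the domain) means `y_i = lam_i x_i` for all `i`. -/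
def IsDiagonal {I : Type*} (T : H →ₗ.[ℂ] H) (b : HilbertBasis I ℂ H) (lam : I → ℝ) : Prop :=
  ∀ x y : H, (x, y) ∈ T.graph ↔ ∀ i, inner ℂ (b i) y = lam i * inner ℂ (b i) x

theorem graph_inner_comm [CompleteSpace H] {A : H →ₗ.[ℂ] H} (hA : IsSelfAdjoint A) {x y u v : H}
    (hx : (x, y) ∈ A.graph) (hu : (u, v) ∈ A.graph) : inner ℂ y u = inner ℂ x v := by
  have h := LinearPMap.adjoint_isFormalAdjoint hA.dense_domain
  rw [LinearPMap.isSelfAdjoint_def.mp hA] at h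
  rw [LinearPMap.mem_graph_iff] at hx hu
  obtain ⟨x', rfl, rfl⟩ := hx
  obtain ⟨u', rfl, rfl⟩ := hu
  exact h x' u'

theorem isResolventPoint_iff_graph {T : H →ₗ.[ℂ] H} {z : ℂ} :
    IsResolventPoint T z ↔ ∃ R : H →L[ℂ] H, (∀ y, (R y, y + z • R y) ∈ T.graph) ∧
      ∀ x y, (x, y) ∈ T.graph → R (y - z • x) = x := by
  refine exists_congr fun R => and_congr (forall_congr' fun y => ?_) ⟨fun h x y hxy => ?_, ?_⟩
  · rw [LinearPMap.mem_graph_iff]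
    constructor
    · rintro ⟨h, e⟩
      exact ⟨⟨R y, h⟩, rfl, sub_eq_iff_eq_add.mp e⟩
    · rintro ⟨x, e, e'⟩
      simp only at e e'
      refine ⟨e ▸ x.2, ?_⟩
      have : x = ⟨R y, e ▸ x.2⟩ := Subtype.ext e
      rw [← this, e']; simp
  · rw [LinearPMap.mem_graph_iff] at hxy
    obtain ⟨x', rfl, rfl⟩ := hxy
    exact h x'
  · intro h x
    exact h _ _ (LinearPMap.mem_graph T x)

theorem mem_eigenspace_iff_graph {T : H →ₗ.[ℂ] H} {z : ℂ} {x : H} :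
    x ∈ eigenspace T z ↔ (x, z • x) ∈ T.graph := by
  rw [mem_eigenspace, LinearPMap.mem_graph_iff]
  constructor
  · rintro ⟨h, e⟩; exact ⟨⟨x, h⟩, rfl, e⟩
  · rintro ⟨x', rfl, e⟩; exact ⟨x'.2, e⟩

/-- The nonzero spectrum of the resolvent `R` at the point `t` is the image of the spectrum of `T`
under `z ↦ (z - t)⁻¹`. -/
theorem mem_opSpectrum_of_mem_spectrum {T : H →ₗ.[ℂ] H} {t : ℝ} {R : H →L[ℂ] H}
    (hR : ∀ y, (R y, y + (t : ℂ) • R y) ∈ T.graph)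
    (hR' : ∀ x y, (x, y) ∈ T.graph → R (y - (t : ℂ) • x) = x)
    {s : ℝ} (hs : s ≠ 0) (h : s ∈ spectrum ℝ R) : ((t + s⁻¹ : ℝ) : ℂ) ∈ opSpectrum T := by
  intro hres
  obtain ⟨S, hS, hS'⟩ := isResolventPoint_iff_graph.mp hres
  apply h
  have hsc : (s : ℂ) ≠ 0 := by exact_mod_cast hs
  -- the inverse of `s - R` is `s⁻¹ + s⁻² S`
  have key1 : ∀ y, R y + (s : ℂ)⁻¹ • R (S y) = S y := fun y => by
    have := hR' _ _ (hS y)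
    rw [← this, ← map_smul, ← map_add]
    congr 1
    rw [this]
    push_cast
    module
  have key2 : ∀ y, S y = R y + (s : ℂ)⁻¹ • S (R y) := fun y => by
    have := hS' _ _ (hR y)
    have e : S (y - (s : ℂ)⁻¹ • R y) = R y := by
      convert this using 2
      push_cast
      module
    rw [map_sub, map_smul, sub_eq_iff_eq_add] at e
    exact e
  refine isUnit_iff_exists.mpr ⟨(s : ℂ)⁻¹ • (1 + (s : ℂ)⁻¹ • S), ?_, ?_⟩
  · ext y
    change (s : ℂ) • ((s : ℂ)⁻¹ • (y + (s : ℂ)⁻¹ • S y)) -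
      R ((s : ℂ)⁻¹ • (y + (s : ℂ)⁻¹ • S y)) = y
    rw [smul_inv_smul₀ hsc, map_smul, map_add, map_smul, key1 y, add_sub_cancel_right]
  · ext y
    change (s : ℂ)⁻¹ • (((s : ℂ) • y - R y) + (s : ℂ)⁻¹ • S ((s : ℂ) • y - R y)) = y
    rw [map_sub, map_smul, smul_sub, inv_smul_smul₀ hsc]
    conv_lhs => rw [key2 y]
    rw [show (s : ℂ) • y - R y + (R y + (s : ℂ)⁻¹ • S (R y) - (s : ℂ)⁻¹ • S (R y)) = (s : ℂ) • y by
      abel, inv_smul_smul₀ hsc]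

/-- If the nonzero spectrum of a bounded self-adjoint operator `R` consists of isolated points, then
the range of `R` lies in the closed span of its eigenvectors: by the continuous functional calculus,
`R` is the norm limit of the finite sums `∑ s P_s` over the spectral points `s` with `δ ≤ |s|`,
where `P_s` is the spectral projection for `{s}`. -/
theorem mem_closure_span_eigenvectors [CompleteSpace H] {R : H →L[ℂ] H} (hR : IsSelfAdjoint R)
    {ι : Type*} (e : ι → H)
    (hiso : ∀ s ∈ spectrum ℝ R, s ≠ 0 → ∀ᶠ s' in 𝓝 s, s' ∈ spectrum ℝ R → s' = s)
    (heig : ∀ s ∈ spectrum ℝ R, s ≠ 0 → ∀ x, R x = (s : ℂ) • x → x ∈ Submodule.span ℂ (range e))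
    (x : H) : R x ∈ (Submodule.span ℂ (range e)).topologicalClosure := by
  -- every function vanishing near the origin is continuous on the spectrum
  have hcont : ∀ f : ℝ → ℝ, (∀ᶠ s in 𝓝 0, f s = 0) → ContinuousOn f (spectrum ℝ R) := by
    intro f hf s hs
    by_cases h0 : s = 0
    · subst h0
      have : f =ᶠ[𝓝 0] fun _ => 0 := hf
      exact (continuousAt_const.congr this.symm).continuousWithinAt
    · refine continuousWithinAt_const.congr_of_eventuallyEq (f := fun _ => f s) ?_ rfl
      filter_upwards [mem_nhdsWithin_of_mem_nhds (hiso s hs h0), self_mem_nhdsWithin] with s' h1 h2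
      rw [h1 h2]
  rw [← SetLike.mem_coe, Submodule.topologicalClosure_coe, Metric.mem_closure_iff]
  intro ε hε
  obtain ⟨δ, hδ, hδε⟩ : ∃ δ > 0, δ * ‖x‖ < ε :=
    ⟨ε / (‖x‖ + 1), by positivity, by
      rw [div_mul_eq_mul_div, div_lt_iff₀ (by positivity)]; nlinarith [norm_nonneg x]⟩
  set S : Set ℝ := spectrum ℝ R ∩ {s | δ ≤ |s|} with hS
  have hScomp : IsCompact S :=
    (spectrum.isCompact R).inter_right (isClosed_le continuous_const continuous_abs)
  have hSfin : S.Finite := by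
    refine hScomp.finite (isDiscrete_iff_discreteTopology.mpr ?_)
    rw [discreteTopology_subtype_iff]
    intro s hs
    rw [inf_principal_eq_bot]
    have h0 : s ≠ 0 := by
      rintro rfl; have := hs.2; simp at this; linarith
    filter_upwards [mem_nhdsWithin_of_mem_nhds (hiso s hs.1 h0), self_mem_nhdsWithin] with s' h1 h2 h3
    exact h2 (h1 h3.1)
  let ind : ℝ → ℝ → ℝ := fun s s' => if s' = s then 1 else 0
  have hind : ∀ s ∈ S, ContinuousOn (ind s) (spectrum ℝ R) := by
    intro s hs
    apply hcont
    have h0 : (0 : ℝ) ≠ s := by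
      rintro rfl; have := hs.2; simp at this; linarith
    filter_upwards [isOpen_ne.mem_nhds h0] with s' hs'
    exact if_neg hs'
  set f : ℝ → ℝ := fun s' => ∑ s ∈ hSfin.toFinset, s * ind s s' with hf
  have hfS : ∀ s' ∈ spectrum ℝ R, s' - f s' = if δ ≤ |s'| then 0 else s' := by
    intro s' hs'
    simp only [hf, ind, mul_ite, mul_one, mul_zero, Finset.sum_ite_eq, Finite.mem_toFinset]
    by_cases h : δ ≤ |s'|
    · rw [if_pos (hSfin.mem_toFinset.mpr ⟨hs', h⟩), if_pos h, sub_self]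
    · rw [if_neg (fun h' => h (hSfin.mem_toFinset.mp h').2), if_neg h, sub_zero]
  have hfc : ContinuousOn f (spectrum ℝ R) :=
    continuousOn_finsetSum _ fun s hs =>
      continuousOn_const.mul (hind s (hSfin.mem_toFinset.mp hs))
  have hnorm : ‖R - cfc f R‖ ≤ δ := by
    have : R - cfc f R = cfc (fun s => s - f s) R := by
      rw [cfc_sub (fun s => s) f R continuousOn_id hfc, cfc_id' ℝ R]
    rw [this]
    refine norm_cfc_le hδ.le fun s hs => ?_
    simp only [hfS s hs]
    split_ifs with h
    · simpa using hδ.le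
    · exact (not_le.mp h).le
  refine ⟨cfc f R x, ?_, ?_⟩
  · have : cfc f R = ∑ s ∈ hSfin.toFinset, cfc (fun s' => s * ind s s') R := by
      rw [← cfc_sum (fun s s' => s * ind s s') R _ fun s hs =>
        continuousOn_const.mul (hind s (hSfin.mem_toFinset.mp hs))]
      congr 1; ext; simp [hf]
    rw [this, _root_.sum_apply]
    refine Submodule.sum_mem _ fun s hs => ?_
    have hs := hSfin.mem_toFinset.mp hs
    refine heig s hs.1 (by rintro rfl; have := hs.2; simp at this; linarith) _ ?_
    have hc : ContinuousOn (fun s' => s * ind s s') (spectrum ℝ R) :=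
      continuousOn_const.mul (hind s hs)
    have : R * cfc (fun s' => s * ind s s') R = s • cfc (fun s' => s * ind s s') R := by
      rw [← cfc_smul s _ R hc]
      nth_rewrite 1 [← cfc_id' ℝ R]
      rw [← cfc_mul (fun s => s) _ R continuousOn_id hc]
      refine cfc_congr fun s' _ => ?_
      simp only [ind, smul_eq_mul]
      split_ifs with h
      · rw [h]
      · simp
    exact DFunLike.congr_fun this x
  · rw [dist_eq_norm, ← _root_.sub_apply]
    exact ((R - cfc f R).le_opNorm x).trans_lt
      ((mul_le_mul_of_nonneg_right hnorm (norm_nonneg x)).trans_lt hδε)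

/-- A self-adjoint operator with simple, separated spectrum is diagonal in an orthonormal basis
indexed by the eigenvalues. -/
theorem exists_isDiagonal [CompleteSpace H]
    {A : H →ₗ.[ℂ] H} (hA : IsSelfAdjoint A) (hdisc : HasSimpleDiscreteSpectrum A)
    {I : Type*} {lam : I → ℝ}
    (hlam : Set.range (fun n => (lam n : ℂ)) = opSpectrum A)
    {d : ℝ} (hd : 0 < d) (hsep : ∀ m n, m ≠ n → d ≤ |lam m - lam n|) :
    ∃ b : HilbertBasis I ℂ H, IsDiagonal A b lam := by
  have hspec : ∀ n, (lam n : ℂ) ∈ opSpectrum A := fun n => hlam ▸ mem_range_self n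
  obtain ⟨t, ht⟩ : ∃ t : ℝ, ∀ i, lam i ≠ t := by
    by_cases hI : Nonempty I
    · obtain ⟨i⟩ := hI
      refine ⟨lam i + d / 2, fun j h => ?_⟩
      by_cases hij : j = i
      · subst hij; linarith
      · have := hsep j i hij
        rw [h, add_sub_cancel_left, abs_of_pos (by linarith)] at this
        linarith
    · exact ⟨0, fun i => (hI ⟨i⟩).elim⟩
  have hres : IsResolventPoint A (t : ℂ) := by
    by_contra h
    have : (t : ℂ) ∈ opSpectrum A := h
    rw [← hlam] at this
    obtain ⟨i, hi⟩ := this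
    exact ht i (Complex.ofReal_injective hi)
  obtain ⟨R, hR, hR'⟩ := isResolventPoint_iff_graph.mp hres
  have hRsa : IsSelfAdjoint R := by
    rw [ContinuousLinearMap.isSelfAdjoint_iff_isSymmetric]
    intro x y
    have := graph_inner_comm hA (hR x) (hR y)
    simp only [inner_add_left, inner_add_right, inner_smul_left, inner_smul_right,
      Complex.conj_ofReal] at this
    exact (add_right_cancel this).symm
  -- unit eigenvectors
  have hex : ∀ n, ∃ v : H, ‖v‖ = 1 ∧ (v, (lam n : ℂ) • v) ∈ A.graph ∧
      ∀ w ∈ eigenspace A (lam n), w ∈ Submodule.span ℂ {v} := by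
    intro n
    obtain ⟨v, hv0, hv⟩ := finrank_eq_one_iff'.mp (hdisc.simple _ (hspec n))
    have hv0' : (v : H) ≠ 0 := by simpa using hv0
    have hn : (‖(v : H)‖ : ℂ) ≠ 0 := by simpa using hv0'
    refine ⟨(‖(v : H)‖⁻¹ : ℂ) • (v : H), ?_, ?_, ?_⟩
    · rw [norm_smul]; simp [hv0']
    · exact mem_eigenspace_iff_graph.mp (Submodule.smul_mem _ _ v.2)
    · intro w hw
      obtain ⟨c, hc⟩ := hv ⟨w, hw⟩
      rw [Submodule.mem_span_singleton]
      refine ⟨c * ‖(v : H)‖, ?_⟩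
      rw [smul_smul, mul_assoc, mul_inv_cancel₀ hn, mul_one]
      exact congrArg Subtype.val hc
  choose e he1 heg hespan using hex
  have horth : Orthonormal ℂ e := by
    refine ⟨he1, fun m n hmn => ?_⟩
    have := graph_inner_comm hA (heg m) (heg n)
    rw [inner_smul_left, inner_smul_right, Complex.conj_ofReal] at this
    have h2 : ((lam m : ℂ) - lam n) * inner ℂ (e m) (e n) = 0 := by rw [sub_mul, this, sub_self]
    rcases mul_eq_zero.mp h2 with h | h
    · have h3 : lam m - lam n = 0 := by exact_mod_cast h
      have := hsep m n hmn
      rw [h3, abs_zero] at this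
      linarith
    · exact h
  have hmem : ∀ s ∈ spectrum ℝ R, s ≠ 0 → ∃ i, lam i = t + s⁻¹ := by
    intro s hs h0
    have := mem_opSpectrum_of_mem_spectrum hR hR' h0 hs
    rw [← hlam] at this
    obtain ⟨i, hi⟩ := this
    exact ⟨i, Complex.ofReal_injective hi⟩
  have hRspan : ∀ x, R x ∈ (Submodule.span ℂ (range e)).topologicalClosure := by
    refine mem_closure_span_eigenvectors hRsa e ?_ ?_
    · intro s hs h0
      have h1 : ∀ᶠ s' in 𝓝 s, dist s'⁻¹ s⁻¹ < d :=
        (continuousAt_inv₀ h0).eventually (Metric.ball_mem_nhds _ hd)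
      filter_upwards [h1, isOpen_ne.mem_nhds h0] with s' h1 h2 h3
      obtain ⟨i, hi⟩ := hmem s hs h0
      obtain ⟨j, hj⟩ := hmem s' h3 h2
      by_contra hne
      have hij : j ≠ i := by
        rintro rfl
        exact hne (inv_injective (by linarith))
      have := hsep j i hij
      rw [hi, hj, add_sub_add_left_eq_sub, ← Real.dist_eq] at this
      linarith
    · intro s hs h0 x hx
      obtain ⟨i, hi⟩ := hmem s hs h0
      have hsc : (s : ℂ) ≠ 0 := by exact_mod_cast h0
      have hxA : x ∈ eigenspace A (lam i) := by
        rw [mem_eigenspace_iff_graph]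
        have := A.graph.smul_mem (s : ℂ)⁻¹ (hR x)
        rw [hx] at this
        convert this using 1
        simp only [Prod.smul_mk, smul_smul, smul_add, inv_mul_cancel₀ hsc, one_smul, hi]
        congr 1
        push_cast
        rw [add_smul, add_comm]
        congr 2
        field_simp
      have := hespan i x hxA
      exact Submodule.span_mono (singleton_subset_iff.mpr (mem_range_self i)) this
  have hdense : ⊤ ≤ (Submodule.span ℂ (range e)).topologicalClosure := by
    intro x _
    have hx : x ∈ closure (A.domain : Set H) := hA.dense_domain x
    refine closure_minimal ?_ (Submodule.isClosed_topologicalClosure _) hx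
    intro y hy
    have := hR' _ _ (LinearPMap.mem_graph A ⟨y, hy⟩)
    rw [SetLike.mem_coe]
    simp only at this
    rw [← this]
    exact hRspan _
  refine ⟨HilbertBasis.mk horth hdense, fun x y => ?_⟩
  simp only [HilbertBasis.coe_mk]
  constructor
  · intro h i
    have := graph_inner_comm hA (heg i) h
    rw [← this, inner_smul_left, Complex.conj_ofReal]
  · intro h
    have hx : R (y - (t : ℂ) • x) = x := by
      refine (HilbertBasis.mk horth hdense).repr.injective (lp.ext (funext fun i => ?_))
      simp only [HilbertBasis.repr_apply_apply, HilbertBasis.coe_mk]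
      have h1 := graph_inner_comm hA (heg i) (hR (y - (t : ℂ) • x))
      simp only [inner_smul_left, inner_add_right, inner_sub_right, inner_smul_right,
        Complex.conj_ofReal, h i] at h1
      have hne : (lam i : ℂ) - t ≠ 0 := by
        rw [sub_ne_zero]; exact_mod_cast ht i
      refine mul_left_cancel₀ hne ?_
      linear_combination h1
    have := hR (y - (t : ℂ) • x)
    rwa [hx, sub_add_cancel] at this

end Diagonalisation

/-! ### Local expansion of the characteristic function -/

section CharacteristicFunction

variable {I : Type*}

/-- The function `w ↦ 1 + ∑ c_i / (a_i - w)`. For `c_i = ⟨b_i, φ⟩ ⟨ψ, b_i⟩` and `a_i = lam_i`, it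
is `1 + ⟨(A - w)⁻¹ ψ, φ⟩`, the perturbation determinant of the rank one perturbation. -/
noncomputable def charFun (c a : I → ℂ) (w : ℂ) : ℂ := 1 + ∑' i, c i / (a i - w)

theorem half_le_norm_sub {a z w : ℂ} {δ : ℝ} (h : δ ≤ ‖a - z‖) (hw : ‖w - z‖ < δ / 2) :
    δ / 2 ≤ ‖a - w‖ := by
  have h1 := norm_add_le (a - w) (w - z)
  rw [sub_add_sub_cancel] at h1
  linarith

theorem summable_div_sub {c a : I → ℂ} (hc : Summable c) {w : ℂ} {δ : ℝ} (hδ : 0 < δ)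
    (h : ∀ i, c i ≠ 0 → δ ≤ ‖a i - w‖) : Summable fun i => c i / (a i - w) := by
  refine Summable.of_norm_bounded (hc.norm.div_const δ) fun i => ?_
  by_cases hi : c i = 0
  · simp [hi]
  · rw [norm_div]
    gcongr
    exact h i hi

theorem analyticAt_tsum_div_sub {c a : I → ℂ} (hc : Summable c) {z : ℂ} {δ : ℝ} (hδ : 0 < δ)
    (h : ∀ i, c i ≠ 0 → δ ≤ ‖a i - z‖) : AnalyticAt ℂ (fun w => ∑' i, c i / (a i - w)) z := by
  have hb : ∀ i, c i ≠ 0 → ∀ w ∈ Metric.ball z (δ / 2), δ / 2 ≤ ‖a i - w‖ := by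
    intro i hi w hw
    exact half_le_norm_sub (h i hi) (by rwa [Metric.mem_ball, dist_eq_norm] at hw)
  have hd : DifferentiableOn ℂ (fun w => ∑' i, c i / (a i - w)) (Metric.ball z (δ / 2)) := by
    refine Complex.differentiableOn_tsum_of_summable_norm (hc.norm.div_const (δ / 2)) ?_
      Metric.isOpen_ball ?_
    · intro i w hw
      by_cases hi : c i = 0
      · simp only [hi, zero_div]; fun_prop
      · have : a i - w ≠ 0 := by
          have := hb i hi w hw
          intro h0
          rw [h0, norm_zero] at this
          linarith
        exact ((differentiableAt_const _).div (by fun_prop) this).differentiableWithinAt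
    · intro i w hw
      by_cases hi : c i = 0
      · simp [hi]
      · rw [norm_div]
        gcongr
        exact hb i hi w hw
  exact hd.analyticAt (Metric.ball_mem_nhds _ (by positivity))

/-- Removing the coefficient of the pole at `z`. -/
noncomputable def regCoeff (c a : I → ℂ) (z : ℂ) (i : I) : ℂ :=
  open Classical in if a i = z then 0 else c i

/-- The Taylor coefficient of order `j` at `z` of the regular part of `charFun`. The summand with
`a i = z` vanishes, because its denominator does. -/
noncomputable def taylorCoeff (c a : I → ℂ) (z : ℂ) (j : ℕ) : ℂ :=
  (if j = 0 then 1 else 0) + ∑' i, c i / (a i - z) ^ (j + 1)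

theorem regCoeff_ne_zero {c a : I → ℂ} {z : ℂ} {i : I} (h : regCoeff c a z i ≠ 0) : a i ≠ z := by
  intro h'; simp [regCoeff, h'] at h

theorem summable_regCoeff {c a : I → ℂ} (hc : Summable c) (z : ℂ) : Summable (regCoeff c a z) := by
  refine Summable.of_norm_bounded hc.norm fun i => ?_
  rw [regCoeff]; split_ifs <;> simp

/-- The `m`-th Taylor remainder at `z` of the regular part of `charFun`. -/
noncomputable def taylorRem (c a : I → ℂ) (z : ℂ) (m : ℕ) (w : ℂ) : ℂ :=
  (if m = 0 then 1 else 0) + ∑' i, (regCoeff c a z i / (a i - z) ^ m) / (a i - w)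

section

variable {c a : I → ℂ} {z : ℂ} {δ : ℝ}

theorem summable_regCoeff_div_pow (hc : Summable c) (hδ : 0 < δ)
    (h : ∀ i, a i ≠ z → δ ≤ ‖a i - z‖) (m : ℕ) :
    Summable fun i => regCoeff c a z i / (a i - z) ^ m := by
  refine Summable.of_norm_bounded ((summable_regCoeff (a := a) hc z).norm.div_const (δ ^ m))
    fun i => ?_
  by_cases hi : regCoeff c a z i = 0
  · simp [hi]
  · rw [norm_div, norm_pow]
    gcongr
    exact h i (regCoeff_ne_zero hi)

theorem analyticAt_taylorRem (hc : Summable c) (hδ : 0 < δ)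
    (h : ∀ i, a i ≠ z → δ ≤ ‖a i - z‖) (m : ℕ) : AnalyticAt ℂ (taylorRem c a z m) z := by
  refine analyticAt_const.add (analyticAt_tsum_div_sub (summable_regCoeff_div_pow hc hδ h m) hδ ?_)
  intro i hi
  refine h i (regCoeff_ne_zero (c := c) fun h0 => hi (by rw [h0, zero_div]))

theorem taylorRem_self (m : ℕ) : taylorRem c a z m z = taylorCoeff c a z m := by
  rw [taylorRem, taylorCoeff]
  congr 1
  refine tsum_congr fun i => ?_
  by_cases hi : a i = z
  · simp [hi]
  · rw [regCoeff, if_neg hi, div_div, pow_succ]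

/-- The recursion of the Taylor remainders, a consequence of
`1 / (x - ε) = 1 / x + ε / (x (x - ε))`. -/
theorem taylorRem_eq (hc : Summable c) (hδ : 0 < δ)
    (h : ∀ i, a i ≠ z → δ ≤ ‖a i - z‖) (m : ℕ) {w : ℂ} (hw : ‖w - z‖ < δ / 2) :
    taylorRem c a z m w = taylorCoeff c a z m + (w - z) * taylorRem c a z (m + 1) w := by
  have hb : ∀ i, a i ≠ z → δ / 2 ≤ ‖a i - w‖ := fun i hi => half_le_norm_sub (h i hi) hw
  have hs1 := summable_div_sub (a := a) (w := w) (summable_regCoeff_div_pow hc hδ h (m + 1))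
    (half_pos hδ) fun i hi => hb i (regCoeff_ne_zero (c := c) fun h0 => hi (by rw [h0, zero_div]))
  have hs2 := summable_regCoeff_div_pow hc hδ h (m + 1)
  rw [← taylorRem_self, taylorRem, taylorRem, taylorRem, if_neg (Nat.succ_ne_zero m), zero_add,
    add_assoc, ← tsum_mul_left, ← Summable.tsum_add ?_ (hs1.mul_left _)]
  · congr 1
    refine tsum_congr fun i => ?_
    by_cases hi : a i = z
    · simp [regCoeff, hi]
    · have h1 : a i - z ≠ 0 := sub_ne_zero.mpr hi
      have h2 : a i - w ≠ 0 := by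
        intro h0
        have := hb i hi
        rw [h0, norm_zero] at this
        linarith
      field_simp
      ring
  · exact hs2.congr fun i => by rw [div_div, pow_succ]

theorem taylorRem_zero_eventuallyEq (hc : Summable c) (hδ : 0 < δ)
    (h : ∀ i, a i ≠ z → δ ≤ ‖a i - z‖) {m : ℕ} (hm : ∀ j < m, taylorCoeff c a z j = 0) :
    ∀ᶠ w in 𝓝 z, taylorRem c a z 0 w = (w - z) ^ m * taylorRem c a z m w := by
  filter_upwards [Metric.ball_mem_nhds z (half_pos hδ)] with w hw
  rw [Metric.mem_ball, dist_eq_norm] at hw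
  induction m with
  | zero => simp
  | succ m ih =>
    rw [ih fun j hj => hm j (by omega), taylorRem_eq hc hδ h m hw, hm m (by omega)]
    ring

theorem meromorphicOrderAt_taylorRem (hc : Summable c) (hδ : 0 < δ)
    (h : ∀ i, a i ≠ z → δ ≤ ‖a i - z‖) {m : ℕ} (hm : ∀ j < m, taylorCoeff c a z j = 0)
    (hm' : taylorCoeff c a z m ≠ 0) : meromorphicOrderAt (taylorRem c a z 0) z = (m : ℤ) := by
  rw [meromorphicOrderAt_eq_int_iff (analyticAt_taylorRem hc hδ h 0).meromorphicAt]
  refine ⟨_, analyticAt_taylorRem hc hδ h m, by rwa [taylorRem_self], ?_⟩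
  filter_upwards [(taylorRem_zero_eventuallyEq hc hδ h hm).filter_mono nhdsWithin_le_nhds] with w hw
  rw [hw, zpow_natCast, smul_eq_mul]

/-- A function of finite order has a first nonvanishing Taylor coefficient. -/
theorem exists_taylorCoeff_ne_zero (hc : Summable c) (hδ : 0 < δ)
    (h : ∀ i, a i ≠ z → δ ≤ ‖a i - z‖) (ht : meromorphicOrderAt (taylorRem c a z 0) z ≠ ⊤) :
    ∃ m, (∀ j < m, taylorCoeff c a z j = 0) ∧ taylorCoeff c a z m ≠ 0 := by
  classical
  by_cases hex : ∃ m, taylorCoeff c a z m ≠ 0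
  · exact ⟨Nat.find hex, fun j hj => not_not.mp (Nat.find_min hex hj), Nat.find_spec hex⟩
  · push Not at hex
    obtain ⟨n, hn⟩ := WithTop.ne_top_iff_exists.mp ht
    have key : ∀ m : ℕ, (m : ℤ) ≤ n := by
      intro m
      have h1 : meromorphicOrderAt (taylorRem c a z 0) z =
          meromorphicOrderAt ((fun w => (w - z) ^ m) * taylorRem c a z m) z :=
        meromorphicOrderAt_congr ((taylorRem_zero_eventuallyEq hc hδ h fun j _ => hex j).filter_mono
          nhdsWithin_le_nhds)
      have h2 : MeromorphicAt (fun w : ℂ => (w - z) ^ m) z := by fun_prop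
      rw [meromorphicOrderAt_mul h2 (analyticAt_taylorRem hc hδ h m).meromorphicAt] at h1
      have h3 : meromorphicOrderAt (fun w : ℂ => (w - z) ^ m) z = (m : ℤ) := by
        rw [meromorphicOrderAt_eq_int_iff h2]
        exact ⟨fun _ => 1, analyticAt_const, one_ne_zero, Eventually.of_forall fun w => by simp⟩
      have h4 := (analyticAt_taylorRem (c := c) hc hδ h m).meromorphicOrderAt_nonneg
      rw [← hn, h3] at h1
      have h5 : ((m : ℤ) : WithTop ℤ) ≤ (n : WithTop ℤ) := by
        rw [h1]; exact le_add_of_nonneg_right h4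
      exact_mod_cast h5
    have := key (n.toNat + 1)
    omega

theorem charFun_eq_taylorRem (h : ∀ i, a i = z → c i = 0) :
    charFun c a = taylorRem c a z 0 := by
  ext w
  simp only [charFun, taylorRem, if_true, pow_zero, div_one]
  congr 1
  refine tsum_congr fun i => ?_
  by_cases hi : a i = z
  · simp [regCoeff, hi, h i hi]
  · simp [regCoeff, hi]

/-- The Laurent expansion of `charFun` at a pole: the principal part is `-c n / (w - z)`. -/
theorem charFun_eventuallyEq_of_pole (hc : Summable c) (ha : Function.Injective a) (hδ : 0 < δ)
    (h : ∀ i, a i ≠ z → δ ≤ ‖a i - z‖) {n : I} (hn : a n = z) :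
    ∀ᶠ w in 𝓝[≠] z, charFun c a w =
      (w - z) ^ (-1 : ℤ) • (-c n + (w - z) * taylorRem c a z 0 w) := by
  classical
  filter_upwards [self_mem_nhdsWithin,
    mem_nhdsWithin_of_mem_nhds (Metric.ball_mem_nhds z (half_pos hδ))] with w hw1 hw2
  rw [Metric.mem_ball, dist_eq_norm] at hw2
  have hne : w - z ≠ 0 := sub_ne_zero.mpr hw1
  have hb : ∀ i, a i ≠ z → δ / 2 ≤ ‖a i - w‖ := fun i hi => half_le_norm_sub (h i hi) hw2
  have hs : Summable fun i => c i / (a i - w) := by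
    refine summable_div_sub hc (δ := min (δ / 2) ‖w - z‖) (by positivity) fun i _ => ?_
    by_cases hi : a i = z
    · rw [hi, norm_sub_rev]; exact min_le_right _ _
    · exact (min_le_left _ _).trans (hb i hi)
  rw [charFun, hs.tsum_eq_add_tsum_ite n, taylorRem, if_pos rfl, hn]
  have : ∀ i, (if i = n then 0 else c i / (a i - w)) =
      regCoeff c a z i / (a i - z) ^ 0 / (a i - w) := by
    intro i
    by_cases hi : i = n
    · simp [regCoeff, hi, hn]
    · have : a i ≠ z := fun h' => hi (ha (h'.trans hn.symm))
      simp [regCoeff, hi, this]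
  simp only [this, zpow_neg, zpow_one, smul_eq_mul]
  rw [mul_add, inv_mul_cancel_left₀ hne, ← neg_sub w z, div_neg]
  field_simp
  ring

theorem meromorphicAt_charFun (hc : Summable c) (ha : Function.Injective a) (hδ : 0 < δ)
    (h : ∀ i, a i ≠ z → δ ≤ ‖a i - z‖) : MeromorphicAt (charFun c a) z := by
  by_cases hz : ∃ n, a n = z
  · obtain ⟨n, hn⟩ := hz
    refine MeromorphicAt.congr ?_
      ((charFun_eventuallyEq_of_pole hc ha hδ h hn).mono fun w hw => hw.symm)
    have := (analyticAt_taylorRem hc hδ h 0).meromorphicAt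
    fun_prop
  · push Not at hz
    rw [charFun_eq_taylorRem fun i hi => (hz i hi).elim]
    exact (analyticAt_taylorRem hc hδ h 0).meromorphicAt

theorem meromorphicOrderAt_charFun_of_pole (hc : Summable c) (ha : Function.Injective a)
    (hδ : 0 < δ) (h : ∀ i, a i ≠ z → δ ≤ ‖a i - z‖) {n : I} (hn : a n = z) (hcn : c n ≠ 0) :
    meromorphicOrderAt (charFun c a) z = (-1 : ℤ) := by
  rw [meromorphicOrderAt_eq_int_iff (meromorphicAt_charFun hc ha hδ h)]
  refine ⟨_, ?_, ?_, charFun_eventuallyEq_of_pole hc ha hδ h hn⟩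
  · have := analyticAt_taylorRem hc hδ h 0
    fun_prop
  · simpa using hcn

end
end CharacteristicFunction

/-! ### Jordan chains from formal power series -/

section JordanChains

variable {H : Type*} [NormedAddCommGroup H] [InnerProductSpace ℂ H]

theorem mem_kerPow_succ_iff_graph {T : H →ₗ.[ℂ] H} {z : ℂ} {k : ℕ} {x : H} :
    x ∈ kerPow T z (k + 1) ↔ ∃ y ∈ kerPow T z k, (x, z • x + y) ∈ T.graph := by
  rw [mem_kerPow_succ]
  constructor
  · rintro ⟨h, e⟩
    refine ⟨_, e, ?_⟩
    rw [add_sub_cancel]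
    exact LinearPMap.mem_graph T ⟨x, h⟩
  · rintro ⟨y, hy, h⟩
    rw [LinearPMap.mem_graph_iff] at h
    obtain ⟨x', rfl, e⟩ := h
    refine ⟨x'.2, ?_⟩
    simp only at e
    simpa [e] using hy

theorem eq_of_graph {T : H →ₗ.[ℂ] H} {z : ℂ} {x y y' : H} (h : (x, z • x + y) ∈ T.graph)
    (h' : (x, z • x + y') ∈ T.graph) : y = y' :=
  add_left_cancel (LinearPMap.mem_graph_snd_inj T h h' rfl)

/-- A formal power series `∑ u_j ε ^ j` with `(T - z - ε) ∑ u_j ε ^ j = (∑ f_j ε ^ j) η` yields a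
Jordan chain of `T` at `z` whose length `m` is the order of `∑ f_j ε ^ j`. Under the stated
conditions this chain is a basis of the root subspace, or of its part in the null-space of a
functional `ℓ` which vanishes on the range of `T - z`. -/
theorem rank_rootSubspace_inf_ker {T : H →ₗ.[ℂ] H} {z : ℂ} {ℓ : H →ₗ[ℂ] ℂ} {u : ℕ → H}
    {f : ℕ → ℂ} {η : H} {m : ℕ}
    (h0 : (u 0, z • u 0 + f 0 • η) ∈ T.graph)
    (hs : ∀ j, (u (j + 1), z • u (j + 1) + (u j + f (j + 1) • η)) ∈ T.graph)
    (hlu : ∀ j, ℓ (u j) = 0)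
    (hl : ∀ x y, (x, z • x + y) ∈ T.graph → ℓ y = 0)
    (hker : ∀ x, (x, z • x) ∈ T.graph → ℓ x = 0 → x ∈ Submodule.span ℂ {u 0})
    (hη : f 0 = 0 → ∀ x, (x, z • x + η) ∉ T.graph)
    (hη0 : η = 0 → u 0 = 0) (hu0 : f 0 = 0 → u 0 ≠ 0)
    (hlt : ∀ j < m, f j = 0) (hfm : f m ≠ 0) :
    Module.rank ℂ ↥(rootSubspace T z ⊓ LinearMap.ker ℓ) = m := by
  have hstep : ∀ j, j + 1 < m → (u (j + 1), z • u (j + 1) + u j) ∈ T.graph := fun j hj => by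
    have := hs j
    rwa [hlt _ hj, zero_smul, add_zero] at this
  -- the part of the root subspace in the kernel of `ℓ` is spanned by the chain
  have hle : ∀ k, ∀ x ∈ kerPow T z k, ℓ x = 0 →
      x ∈ Submodule.span ℂ (u '' {j | j < m}) := by
    intro k
    induction k with
    | zero => intro x hx _; rw [(Submodule.mem_bot ℂ).mp hx]; exact Submodule.zero_mem _
    | succ k ih =>
      intro x hx hlx
      obtain ⟨y, hy, hxy⟩ := mem_kerPow_succ_iff_graph.mp hx
      have hy' := ih y hy (hl x y hxy)
      rcases m with _ | p
      · simp only [not_lt_zero, ofPred_false, image_empty, Submodule.span_empty,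
          Submodule.mem_bot] at hy' ⊢
        rw [hy', add_zero] at hxy
        obtain ⟨a, rfl⟩ := Submodule.mem_span_singleton.mp (hker x hxy hlx)
        have h1 := T.graph.smul_mem a h0
        rw [Prod.smul_mk, smul_add, smul_comm a z] at h1
        have h2 : (0 : H) = a • f 0 • η := eq_of_graph (by rwa [add_zero]) h1
        rw [smul_smul] at h2
        rcases smul_eq_zero.mp h2.symm with h3 | h3
        · rcases mul_eq_zero.mp h3 with h4 | h4
          · rw [h4, zero_smul]
          · exact (hfm h4).elim
        · rw [hη0 h3, smul_zero]
      · have hf0 := hlt 0 (by omega)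
        have hins : u '' {j | j < p + 1} = insert (u p) (u '' {j | j < p}) := by
          rw [← image_insert_eq]; congr 1; ext j; simp; omega
        rw [hins, Submodule.mem_span_insert] at hy'
        obtain ⟨a, w, hw, rfl⟩ := hy'
        -- `w` has a preimage in the span of the chain
        have hpre : ∃ v ∈ Submodule.span ℂ (u '' {j | j < p + 1}), (v, z • v + w) ∈ T.graph := by
          refine Submodule.span_induction (p := fun w _ =>
            ∃ v ∈ Submodule.span ℂ (u '' {j | j < p + 1}), (v, z • v + w) ∈ T.graph)
            ?_ ?_ ?_ ?_ hw
          · rintro _ ⟨j, hj, rfl⟩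
            have hj : j < p := hj
            exact ⟨u (j + 1), Submodule.subset_span ⟨j + 1, show j + 1 < p + 1 by omega, rfl⟩,
              hstep j (by omega)⟩
          · exact ⟨0, Submodule.zero_mem _, by simp⟩
          · rintro w1 w2 _ _ ⟨v1, hv1, hg1⟩ ⟨v2, hv2, hg2⟩
            refine ⟨v1 + v2, Submodule.add_mem _ hv1 hv2, ?_⟩
            have := T.graph.add_mem hg1 hg2
            rwa [Prod.mk_add_mk, show z • v1 + w1 + (z • v2 + w2) = z • (v1 + v2) + (w1 + w2) by
              module] at this
          · rintro b w1 _ ⟨v1, hv1, hg1⟩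
            refine ⟨b • v1, Submodule.smul_mem _ _ hv1, ?_⟩
            have := T.graph.smul_mem b hg1
            rwa [Prod.smul_mk, show b • (z • v1 + w1) = z • (b • v1) + b • w1 by module] at this
        obtain ⟨v, hv, hvw⟩ := hpre
        have hlv : ℓ v = 0 := by
          have : Submodule.span ℂ (u '' {j | j < p + 1}) ≤ LinearMap.ker ℓ :=
            Submodule.span_le.mpr (by rintro _ ⟨j, _, rfl⟩; exact hlu j)
          exact this hv
        have hxv := T.graph.sub_mem hxy hvw
        rw [Prod.mk_sub_mk, show z • x + (a • u p + w) - (z • v + w) =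
          z • (x - v) + a • u p by module] at hxv
        have ha : a = 0 := by
          by_contra ha
          -- otherwise `u p`, and with it `η`, lies in the range of `T - z`
          have h1 := T.graph.smul_mem a⁻¹ hxv
          have h2 := T.graph.sub_mem (hs p) h1
          have h3 := T.graph.smul_mem (f (p + 1))⁻¹ h2
          refine hη hf0 ((f (p + 1))⁻¹ • (u (p + 1) - a⁻¹ • (x - v))) ?_
          convert h3 using 1
          simp only [Prod.smul_mk, Prod.mk_sub_mk]
          congr 1
          rw [smul_add a⁻¹, inv_smul_smul₀ ha,
            show z • u (p + 1) + (u p + f (p + 1) • η) - (a⁻¹ • z • (x - v) + u p) =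
              z • (u (p + 1) - a⁻¹ • (x - v)) + f (p + 1) • η by module,
            smul_add, inv_smul_smul₀ hfm, smul_comm z]
        rw [ha, zero_smul, add_zero] at hxv
        have h4 := hker _ hxv (by rw [map_sub, hlx, hlv, sub_zero])
        have h5 : x - v ∈ Submodule.span ℂ (u '' {j | j < p + 1}) :=
          Submodule.span_mono (singleton_subset_iff.mpr
            (mem_image_of_mem u (show 0 ∈ {j | j < p + 1} from Nat.succ_pos p))) h4
        simpa using Submodule.add_mem _ h5 hv
  have hmem : ∀ k < m, u k ∈ kerPow T z (k + 1) := by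
    intro k
    induction k with
    | zero =>
      intro hk
      refine mem_kerPow_succ_iff_graph.mpr ⟨0, Submodule.zero_mem _, ?_⟩
      rwa [hlt 0 hk, zero_smul] at h0
    | succ k ih =>
      intro hk
      exact mem_kerPow_succ_iff_graph.mpr ⟨u k, ih (by omega), hstep k hk⟩
  have hnot : ∀ k < m, u k ∉ kerPow T z k := by
    intro k
    induction k with
    | zero => exact fun hk h => hu0 (hlt 0 hk) ((Submodule.mem_bot ℂ).mp h)
    | succ k ih =>
      intro hk h
      obtain ⟨y, hy, hxy⟩ := mem_kerPow_succ_iff_graph.mp h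
      rw [← eq_of_graph (hstep k hk) hxy] at hy
      exact ih (by omega) hy
  have hind : ∀ k ≤ m, LinearIndependent ℂ fun j : Fin k => u j := by
    intro k
    induction k with
    | zero => intro _; exact linearIndependent_empty_type
    | succ k ih =>
      intro hk
      rw [linearIndependent_finSucc']
      refine ⟨ih (by omega), fun h => hnot k (by omega) ?_⟩
      refine Submodule.span_le.mpr ?_ h
      rintro _ ⟨j, rfl⟩
      exact kerPow_mono T z (show (j : ℕ) + 1 ≤ k by omega) (hmem j (by omega))
  have heq : rootSubspace T z ⊓ LinearMap.ker ℓ =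
      Submodule.span ℂ (range fun j : Fin m => u j) := by
    have hr : (range fun j : Fin m => u j) = u '' {j | j < m} := by
      ext x
      constructor
      · rintro ⟨j, rfl⟩; exact ⟨j, j.2, rfl⟩
      · rintro ⟨j, hj, rfl⟩; exact ⟨⟨j, hj⟩, rfl⟩
    refine le_antisymm ?_ (Submodule.span_le.mpr ?_)
    · rintro x ⟨hx, hlx⟩
      obtain ⟨k, hk⟩ := (mem_rootSubspace T z x).mp hx
      rw [hr]
      exact hle k x hk hlx
    · rintro _ ⟨j, rfl⟩
      exact ⟨(mem_rootSubspace T z _).mpr ⟨j + 1, hmem j j.2⟩, hlu j⟩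
  have := Module.Finite.span_of_finite ℂ (finite_range fun j : Fin m => u j)
  rw [heq, ← Module.finrank_eq_rank, finrank_span_eq_card (hind m le_rfl), Fintype.card_fin]

theorem algMult_of_rank_inf_ker_zero {T : H →ₗ.[ℂ] H} {z : ℂ} {m : ℕ}
    (h : Module.rank ℂ ↥(rootSubspace T z ⊓ LinearMap.ker (0 : H →ₗ[ℂ] ℂ)) = m) :
    algMult T z = m := by
  rw [LinearMap.ker_zero, inf_top_eq] at h
  rw [algMult, h]; simp

theorem algMult_of_rank_inf_ker {T : H →ₗ.[ℂ] H} {z : ℂ} {m : ℕ} {ℓ : H →ₗ[ℂ] ℂ} {e : H}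
    (he : (e, z • e) ∈ T.graph) (hle : ℓ e = 1)
    (h : Module.rank ℂ ↥(rootSubspace T z ⊓ LinearMap.ker ℓ) = m) :
    algMult T z = (m + 1 : ℕ) := by
  have he0 : e ≠ 0 := by rintro rfl; simp at hle
  have hemem : e ∈ rootSubspace T z := by
    refine (mem_rootSubspace T z e).mpr ⟨1, mem_kerPow_succ_iff_graph.mpr ⟨0, ?_, ?_⟩⟩
    · exact Submodule.zero_mem _
    · rwa [add_zero]
  have hsup : (rootSubspace T z ⊓ LinearMap.ker ℓ) ⊔ Submodule.span ℂ {e} = rootSubspace T z := by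
    refine le_antisymm (sup_le inf_le_left ?_) fun x hx => ?_
    · rwa [Submodule.span_singleton_le_iff_mem]
    · rw [Submodule.mem_sup]
      refine ⟨x - ℓ x • e, ⟨Submodule.sub_mem _ hx (Submodule.smul_mem _ _ hemem), ?_⟩, ℓ x • e,
        Submodule.smul_mem _ _ (Submodule.mem_span_singleton_self e), by simp⟩
      simp [hle]
  have hinf : (rootSubspace T z ⊓ LinearMap.ker ℓ) ⊓ Submodule.span ℂ {e} = ⊥ := by
    rw [eq_bot_iff]
    rintro x ⟨⟨_, hx⟩, hx'⟩
    obtain ⟨a, rfl⟩ := Submodule.mem_span_singleton.mp hx'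
    have : a = 0 := by simpa [hle] using hx
    simp [this]
  have := Submodule.rank_sup_add_rank_inf_eq (rootSubspace T z ⊓ LinearMap.ker ℓ)
    (Submodule.span ℂ {e})
  rw [hsup, hinf, rank_bot, add_zero, h, ← Module.finrank_eq_rank ℂ ↥(Submodule.span ℂ {e}),
    finrank_span_singleton he0] at this
  rw [algMult, this]
  simp

end JordanChains

/-! ### Algebraic multiplicity as the order of the characteristic function -/

section Multiplicity

variable {H : Type*} [NormedAddCommGroup H] [InnerProductSpace ℂ H]
  {I : Type*} {b : HilbertBasis I ℂ H} {lam : I → ℝ} {A : H →ₗ.[ℂ] H} {φ ψ : H} {z : ℂ}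

theorem perturb_graph_iff (hA : IsDiagonal A b lam) {x y : H} :
    (x, z • x + y) ∈ (perturb A φ ψ).graph ↔
      ∀ i, inner ℂ (b i) y = (lam i - z) * inner ℂ (b i) x + inner ℂ φ x * inner ℂ (b i) ψ := by
  have h1 : (x, z • x + y) ∈ (perturb A φ ψ).graph ↔
      (x, z • x + y - inner ℂ φ x • ψ) ∈ A.graph := by
    simp only [LinearPMap.mem_graph_iff]
    constructor
    · rintro ⟨x', rfl, h⟩
      exact ⟨x', rfl, eq_sub_of_add_eq h⟩
    · rintro ⟨x', rfl, h⟩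
      exact ⟨x', rfl, add_eq_of_eq_sub h⟩
  rw [h1, hA]
  refine forall_congr' fun i => ?_
  rw [inner_sub_right, inner_add_right, inner_smul_right, inner_smul_right]
  constructor <;> intro h <;> linear_combination h

theorem ext_coord (b : HilbertBasis I ℂ H) {x y : H}
    (h : ∀ i, inner ℂ (b i) x = inner ℂ (b i) y) : x = y :=
  b.repr.injective (lp.ext (funext fun i => by simpa [HilbertBasis.repr_apply_apply] using h i))

theorem inner_eq_of_coord (b : HilbertBasis I ℂ H) {x y : H}
    (h : ∀ i, inner ℂ φ (b i) * inner ℂ (b i) x = inner ℂ φ (b i) * inner ℂ (b i) y) :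
    inner ℂ φ x = inner ℂ φ y := by
  rw [← b.tsum_inner_mul_inner, ← b.tsum_inner_mul_inner φ y]
  exact tsum_congr h

theorem inner_basis [DecidableEq I] (b : HilbertBasis I ℂ H) (i n : I) :
    inner ℂ (b i) (b n) = if i = n then (1 : ℂ) else 0 :=
  orthonormal_iff_ite.mp b.orthonormal i n

theorem exists_coord_div (b : HilbertBasis I ℂ H) {a : I → ℂ} {δ : ℝ} (hδ : 0 < δ)
    (h : ∀ i, a i ≠ z → δ ≤ ‖a i - z‖) (y : H) :
    ∃ x : H, ∀ i, inner ℂ (b i) x = inner ℂ (b i) y / (a i - z) := by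
  have hmem : Memℓp (fun i => b.repr y i / (a i - z)) 2 := by
    have hy := (memℓp_gen_iff (by norm_num)).mp (lp.memℓp (b.repr y))
    refine (memℓp_gen_iff (by norm_num)).mpr ?_
    refine Summable.of_nonneg_of_le (fun i => by positivity) (fun i => ?_)
      (hy.mul_left ((δ⁻¹) ^ (2 : ENNReal).toReal))
    rw [norm_div, div_eq_inv_mul, Real.mul_rpow (by positivity) (by positivity)]
    refine mul_le_mul_of_nonneg_right (Real.rpow_le_rpow (by positivity) ?_ (by positivity))
      (by positivity)
    by_cases hi : a i = z
    · simp [hi, hδ.le]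
    · exact inv_anti₀ hδ (h i hi)
  refine ⟨b.repr.symm ⟨_, hmem⟩, fun i => ?_⟩
  rw [← HilbertBasis.repr_apply_apply, LinearIsometryEquiv.apply_symm_apply,
    ← HilbertBasis.repr_apply_apply]

/-- The vectors with coordinates `ψ_i / (a_i - z) ^ j`, that is, the images of `ψ` under the powers
of the reduced resolvent at `z`. -/
theorem exists_coord_div_pow (b : HilbertBasis I ℂ H) {a : I → ℂ} {δ : ℝ} (hδ : 0 < δ)
    (h : ∀ i, a i ≠ z → δ ≤ ‖a i - z‖) (ψ : H) :
    ∃ v : ℕ → H, ∀ j i, inner ℂ (b i) (v j) = inner ℂ (b i) ψ / (a i - z) ^ j := by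
  choose S hS using exists_coord_div b hδ h
  refine ⟨fun j => S^[j] ψ, fun j i => ?_⟩
  induction j with
  | zero => simp
  | succ j ih =>
    simp only at ih ⊢
    rw [Function.iterate_succ_apply', hS, ih, div_div, pow_succ]

/-- The summands `⟨b_i, φ⟩ ⟨ψ, b_i⟩` of the scalar product of `ψ` and `φ`. -/
noncomputable def coeff (b : HilbertBasis I ℂ H) (φ ψ : H) (i : I) : ℂ :=
  inner ℂ φ (b i) * inner ℂ (b i) ψ

theorem summable_coeff (b : HilbertBasis I ℂ H) (φ ψ : H) : Summable (coeff b φ ψ) :=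
  b.summable_inner_mul_inner φ ψ

theorem taylorCoeff_eq_inner (b : HilbertBasis I ℂ H) {a : I → ℂ} {v : ℕ → H}
    (hv : ∀ j i, inner ℂ (b i) (v j) = inner ℂ (b i) ψ / (a i - z) ^ j) (j : ℕ) :
    taylorCoeff (coeff b φ ψ) a z j = (if j = 0 then 1 else 0) + inner ℂ φ (v (j + 1)) := by
  rw [taylorCoeff, ← b.tsum_inner_mul_inner]
  congr 1
  refine tsum_congr fun i => ?_
  rw [hv, coeff, mul_div_assoc]

/-- If the eigenvector of `A` at `z` (if there is one) is orthogonal to `φ` and `ψ`, then the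
Jordan chain is given by the power series of `(A - w)⁻¹ ψ` at `z`. -/
theorem rank_of_regular (hA : IsDiagonal A b lam) {δ : ℝ} (hδ : 0 < δ)
    (h : ∀ i, (lam i : ℂ) ≠ z → δ ≤ ‖(lam i : ℂ) - z‖)
    (hreg : ∀ i, (lam i : ℂ) = z → inner ℂ φ (b i) = 0 ∧ inner ℂ (b i) ψ = 0)
    {ℓ : H →ₗ[ℂ] ℂ}
    (hl : ∀ x y, (x, z • x + y) ∈ (perturb A φ ψ).graph → ℓ y = 0)
    (hl0 : ∀ x, (∀ i, (lam i : ℂ) = z → inner ℂ (b i) x = 0) ↔ ℓ x = 0) {m : ℕ}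
    (hlt : ∀ j < m, taylorCoeff (coeff b φ ψ) (fun i => (lam i : ℂ)) z j = 0)
    (hm : taylorCoeff (coeff b φ ψ) (fun i => (lam i : ℂ)) z m ≠ 0) :
    Module.rank ℂ ↥(rootSubspace (perturb A φ ψ) z ⊓ LinearMap.ker ℓ) = m := by
  obtain ⟨v, hv⟩ := exists_coord_div_pow b hδ h ψ
  have hf := taylorCoeff_eq_inner (φ := φ) b hv
  have hsub : ∀ i, (lam i : ℂ) ≠ z → (lam i : ℂ) - z ≠ 0 := fun i hi => sub_ne_zero.mpr hi
  have hf0 := hf 0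
  rw [if_pos rfl, zero_add] at hf0
  refine rank_rootSubspace_inf_ker (u := fun j => v (j + 1)) (η := ψ) ?_ ?_ ?_ hl ?_ ?_ ?_ ?_ hlt hm
  · rw [perturb_graph_iff hA]
    intro i
    rw [hf0, inner_smul_right, zero_add, hv]
    by_cases hi : (lam i : ℂ) = z
    · simp [(hreg i hi).2]
    · field_simp [hsub i hi]
  · intro j
    rw [perturb_graph_iff hA]
    intro i
    rw [hf, inner_add_right, inner_smul_right, if_neg (Nat.succ_ne_zero j), zero_add, hv, hv]
    by_cases hi : (lam i : ℂ) = z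
    · simp [(hreg i hi).2]
    · have := hsub i hi
      field_simp
      ring
  · intro j
    rw [← hl0]
    intro i hi
    rw [hv, (hreg i hi).2, zero_div]
  · intro x hx hlx
    rw [Submodule.mem_span_singleton]
    refine ⟨-inner ℂ φ x, ext_coord b fun i => ?_⟩
    have hx' := (perturb_graph_iff (y := 0) hA).mp (by rwa [add_zero]) i
    rw [inner_zero_right] at hx'
    rw [inner_smul_right, hv]
    by_cases hi : (lam i : ℂ) = z
    · rw [(hreg i hi).2, (hl0 x).mpr hlx i hi]; simp
    · have := hsub i hi
      field_simp
      linear_combination hx'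
  · intro hf00 x hx
    rw [hf00] at hf0
    have h1 : inner ℂ φ x = inner ℂ φ ((1 - inner ℂ φ x) • v 1) := by
      refine inner_eq_of_coord b fun i => ?_
      have hx' := (perturb_graph_iff hA).mp hx i
      by_cases hi : (lam i : ℂ) = z
      · rw [(hreg i hi).1, zero_mul, zero_mul]
      · have := hsub i hi
        rw [inner_smul_right, hv]
        congr 1
        field_simp
        linear_combination -hx'
    rw [inner_smul_right] at h1
    have h2 : (1 : ℂ) = 0 := by linear_combination h1 - (1 - inner ℂ φ x) * hf0
    exact one_ne_zero h2
  · intro h0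
    refine ext_coord b fun i => ?_
    rw [hv, h0]; simp
  · intro hf00 h0
    simp only [zero_add] at h0
    rw [hf00, h0, inner_zero_right] at hf0
    simp at hf0

/-- If `z` is an eigenvalue of `A` whose eigenvector `e` is not orthogonal to `ψ`, then the Jordan
chain is given by the power series of `(w - z) (A - w)⁻¹ ψ` at `z`. -/
theorem algMult_of_inner_basis_ne_zero (hA : IsDiagonal A b lam)
    (hinj : Function.Injective lam) {δ : ℝ} (hδ : 0 < δ)
    (h : ∀ i, (lam i : ℂ) ≠ z → δ ≤ ‖(lam i : ℂ) - z‖)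
    {n : I} (hn : (lam n : ℂ) = z) (hψ : inner ℂ (b n) ψ ≠ 0) {f : ℕ → ℂ}
    (hf0 : f 0 = -coeff b φ ψ n)
    (hfs : ∀ j, f (j + 1) = taylorCoeff (coeff b φ ψ) (fun i => (lam i : ℂ)) z j)
    {m : ℕ} (hlt : ∀ j < m, f j = 0) (hm : f m ≠ 0) : algMult (perturb A φ ψ) z = m := by
  classical
  obtain ⟨v, hv⟩ := exists_coord_div_pow b hδ h ψ
  have hf := taylorCoeff_eq_inner (φ := φ) b hv
  have hsub : ∀ i, i ≠ n → (lam i : ℂ) - z ≠ 0 := fun i hi =>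
    sub_ne_zero.mpr fun h' => hi (hinj (Complex.ofReal_injective (h'.trans hn.symm)))
  have hb0 : b n ≠ 0 := b.orthonormal.ne_zero n
  let u : ℕ → H := fun j => Nat.casesOn j (-inner ℂ (b n) ψ • b n) fun j => v (j + 1)
  have hu0 : u 0 = -inner ℂ (b n) ψ • b n := rfl
  have hus : ∀ j, u (j + 1) = v (j + 1) := fun j => rfl
  have hu0' : u 0 ≠ 0 := by rw [hu0]; simp [hψ, hb0]
  refine algMult_of_rank_inf_ker_zero
    (rank_rootSubspace_inf_ker (u := u) (f := f) (η := ψ) ?_ ?_ ?_ ?_ ?_ ?_ ?_ ?_ hlt hm)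
  · rw [perturb_graph_iff hA]
    intro i
    rw [hf0, hu0, coeff, inner_smul_right, inner_smul_right, inner_smul_right, inner_basis]
    by_cases hi : i = n
    · subst hi; rw [hn]; ring
    · rw [if_neg hi]; ring
  · intro j
    rw [perturb_graph_iff hA]
    intro i
    rw [hfs, hf, hus, inner_add_right, inner_smul_right, hv]
    rcases j with _ | j
    · rw [hu0, inner_smul_right, inner_basis, if_pos rfl]
      by_cases hi : i = n
      · subst hi; rw [hn, if_pos rfl]; ring
      · rw [if_neg hi]
        have := hsub i hi
        field_simp
        ring
    · rw [hus, hv, if_neg (Nat.succ_ne_zero j)]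
      by_cases hi : i = n
      · subst hi; rw [hn]; simp
      · have := hsub i hi
        field_simp
        ring
  · intro j; rfl
  · intro x y _; rfl
  · intro x hx _
    have hx' := fun i => (perturb_graph_iff (y := 0) hA).mp (by rwa [add_zero]) i
    simp only [inner_zero_right] at hx'
    have h1 := hx' n
    rw [hn, sub_self, zero_mul, zero_add] at h1
    have h2 : inner ℂ φ x = 0 := (mul_eq_zero.mp h1.symm).resolve_right hψ
    rw [Submodule.mem_span_singleton]
    refine ⟨-inner ℂ (b n) x / inner ℂ (b n) ψ, ext_coord b fun i => ?_⟩
    rw [hu0, inner_smul_right, inner_smul_right, inner_basis]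
    by_cases hi : i = n
    · subst hi; rw [if_pos rfl]; field_simp
    · rw [if_neg hi, mul_zero, mul_zero]
      have h3 := hx' i
      rw [h2, zero_mul, add_zero] at h3
      exact ((mul_eq_zero.mp h3.symm).resolve_left (hsub i hi)).symm
  · intro hf00 x hx
    have hx' := (perturb_graph_iff hA).mp hx
    have h1 := hx' n
    rw [hn, sub_self, zero_mul, zero_add] at h1
    have h2 : inner ℂ φ x = 1 := by
      refine mul_right_cancel₀ hψ ?_
      rw [← h1, one_mul]
    rw [hf0, coeff, neg_eq_zero] at hf00
    have h3 := (mul_eq_zero.mp hf00).resolve_right hψ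
    have h4 : inner ℂ φ x = inner ℂ φ (0 : H) := by
      refine inner_eq_of_coord b fun i => ?_
      by_cases hi : i = n
      · subst hi; rw [h3, zero_mul, zero_mul]
      · have h5 := hx' i
        rw [h2, one_mul] at h5
        have h6 : ((lam i : ℂ) - z) * inner ℂ (b i) x = 0 := by linear_combination -h5
        rw [(mul_eq_zero.mp h6).resolve_left (hsub i hi), inner_zero_right]
    rw [h2, inner_zero_right] at h4
    exact one_ne_zero h4
  · intro h0
    rw [h0, inner_zero_right] at hψ
    exact (hψ rfl).elim
  · exact fun _ => hu0'

/-- If `z` is an eigenvalue of `A` whose eigenvector `e` is orthogonal to `ψ` but not to `φ`, then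
the Jordan chain is given by the power series of `F(w) ⟨e, φ⟩⁻¹ e - (A - w)⁻¹ ψ` at `z`, where `F`
is the characteristic function. -/
theorem algMult_of_basis_inner_ne_zero (hA : IsDiagonal A b lam)
    (hinj : Function.Injective lam) {δ : ℝ} (hδ : 0 < δ)
    (h : ∀ i, (lam i : ℂ) ≠ z → δ ≤ ‖(lam i : ℂ) - z‖)
    {n : I} (hn : (lam n : ℂ) = z) (hψ : inner ℂ (b n) ψ = 0) (hφ : inner ℂ φ (b n) ≠ 0)
    {m : ℕ} (hlt : ∀ j < m, taylorCoeff (coeff b φ ψ) (fun i => (lam i : ℂ)) z j = 0)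
    (hm : taylorCoeff (coeff b φ ψ) (fun i => (lam i : ℂ)) z m ≠ 0) :
    algMult (perturb A φ ψ) z = (m + 1 : ℕ) := by
  classical
  obtain ⟨v, hv⟩ := exists_coord_div_pow b hδ h ψ
  have hf := taylorCoeff_eq_inner (φ := φ) b hv
  set g := taylorCoeff (coeff b φ ψ) (fun i => (lam i : ℂ)) z with hg
  have hsub : ∀ i, i ≠ n → (lam i : ℂ) - z ≠ 0 := fun i hi =>
    sub_ne_zero.mpr fun h' => hi (hinj (Complex.ofReal_injective (h'.trans hn.symm)))
  have hb0 : b n ≠ 0 := b.orthonormal.ne_zero n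
  set κ : ℂ := inner ℂ φ (b n) with hκ
  let f : ℕ → ℂ := fun j => Nat.casesOn j 0 fun j => -(g j / κ)
  have hf0 : f 0 = 0 := rfl
  have hfs : ∀ j, f (j + 1) = -(g j / κ) := fun j => rfl
  let u : ℕ → H := fun j => (g j / κ) • b n - v (j + 1)
  have hu : ∀ j, u j = (g j / κ) • b n - v (j + 1) := fun j => rfl
  have huφ : ∀ j, inner ℂ φ (u j) = if j = 0 then 1 else 0 := fun j => by
    rw [hu, inner_sub_right, inner_smul_right, ← hκ, div_mul_cancel₀ _ hφ, hf]
    ring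
  refine algMult_of_rank_inf_ker_zero
    (rank_rootSubspace_inf_ker (u := u) (f := f) (η := b n) ?_ ?_ ?_ ?_ ?_ ?_ ?_ ?_ ?_ ?_)
  · rw [perturb_graph_iff hA]
    intro i
    rw [huφ, if_pos rfl, hf0, zero_smul, inner_zero_right, hu, inner_sub_right, inner_smul_right,
      inner_basis, hv]
    by_cases hi : i = n
    · subst hi; rw [hn, hψ]; ring
    · rw [if_neg hi]
      have := hsub i hi
      field_simp
      ring
  · intro j
    rw [perturb_graph_iff hA]
    intro i
    rw [huφ, if_neg (Nat.succ_ne_zero j), hfs, hu, hu, inner_add_right, inner_sub_right,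
      inner_sub_right, inner_smul_right, inner_smul_right, inner_smul_right, inner_basis, hv, hv]
    by_cases hi : i = n
    · subst hi; rw [hn, hψ, if_pos rfl]; ring
    · rw [if_neg hi]
      have := hsub i hi
      field_simp
      ring
  · intro j; rfl
  · intro x y _; rfl
  · intro x hx _
    have hx' := fun i => (perturb_graph_iff (y := 0) hA).mp (by rwa [add_zero]) i
    simp only [inner_zero_right] at hx'
    have h1 : inner ℂ φ (inner ℂ (b n) x • b n - inner ℂ φ x • v 1) = inner ℂ φ x := by
      refine inner_eq_of_coord b fun i => ?_
      rw [inner_sub_right, inner_smul_right, inner_smul_right, inner_basis, hv]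
      by_cases hi : i = n
      · subst hi; rw [if_pos rfl, hψ]; ring
      · have := hsub i hi
        rw [if_neg hi]
        congr 1
        field_simp
        linear_combination hx' i
    rw [inner_sub_right, inner_smul_right, inner_smul_right, ← hκ] at h1
    have h0 := hf 0
    rw [if_pos rfl, zero_add] at h0
    rw [Submodule.mem_span_singleton]
    refine ⟨inner ℂ φ x, ext_coord b fun i => ?_⟩
    rw [hu, inner_smul_right, inner_sub_right, inner_smul_right, inner_basis, hv]
    by_cases hi : i = n
    · subst hi
      rw [if_pos rfl, hψ, zero_div, sub_zero, mul_one, h0]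
      field_simp
      linear_combination -h1
    · rw [if_neg hi]
      have := hsub i hi
      field_simp
      linear_combination κ * hx' i
  · intro _ x hx
    have hx' := (perturb_graph_iff hA).mp hx n
    rw [hn, hψ, inner_basis, if_pos rfl] at hx'
    simp at hx'
  · exact fun h0 => (hb0 h0).elim
  · intro _ h0
    have := huφ 0
    rw [h0, inner_zero_right, if_pos rfl] at this
    exact zero_ne_one this
  · intro j hj
    rcases j with _ | j
    · rfl
    · rw [hfs, hlt j (by omega), zero_div, neg_zero]
  · rw [hfs]
    exact neg_ne_zero.mpr (div_ne_zero hm hφ)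

/-- The Weinstein-Aronszajn formula: the algebraic multiplicity of `z` for the perturbed operator is
the order of the characteristic function at `z`, increased by one if `z` is an eigenvalue of `A`. -/
theorem exists_algMult_eq (hA : IsDiagonal A b lam) (hinj : Function.Injective lam) {δ : ℝ}
    (hδ : 0 < δ) (h : ∀ i, (lam i : ℂ) ≠ z → δ ≤ ‖(lam i : ℂ) - z‖)
    (htop : meromorphicOrderAt (charFun (coeff b φ ψ) (fun i => (lam i : ℂ))) z ≠ ⊤) :
    ∃ m : ℕ, algMult (perturb A φ ψ) z = m ∧
      ((∀ n, (lam n : ℂ) ≠ z) →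
        meromorphicOrderAt (charFun (coeff b φ ψ) fun i => (lam i : ℂ)) z = (m : ℤ)) ∧
      ((∃ n, (lam n : ℂ) = z) →
        meromorphicOrderAt (charFun (coeff b φ ψ) fun i => (lam i : ℂ)) z = ((m - 1 : ℤ) : ℤ)) := by
  classical
  have hinj' : Function.Injective fun i => (lam i : ℂ) := Complex.ofReal_injective.comp hinj
  have hc := summable_coeff b φ ψ
  by_cases hc0 : ∀ i, (lam i : ℂ) = z → coeff b φ ψ i = 0
  · have heq := charFun_eq_taylorRem (a := fun i => (lam i : ℂ)) hc0
    rw [heq] at htop ⊢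
    obtain ⟨m, hlt, hm⟩ := exists_taylorCoeff_ne_zero hc hδ h htop
    rw [meromorphicOrderAt_taylorRem hc hδ h hlt hm]
    by_cases hz : ∃ n, (lam n : ℂ) = z
    · obtain ⟨n, hn⟩ := hz
      refine ⟨m + 1, ?_, fun h' => (h' n hn).elim, fun _ => by simp⟩
      by_cases hψ : inner ℂ (b n) ψ = 0
      · by_cases hφ : inner ℂ φ (b n) = 0
        · have hreg : ∀ i, (lam i : ℂ) = z → i = n := fun i hi => hinj' (hi.trans hn.symm)
          refine algMult_of_rank_inf_ker (ℓ := innerₛₗ ℂ (b n)) (e := b n) ?_ ?_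
            (rank_of_regular hA hδ h ?_ ?_ ?_ hlt hm)
          · have := (perturb_graph_iff (z := z) (φ := φ) (ψ := ψ) (x := b n) (y := 0) hA).mpr
              fun i => by
                rw [hφ, inner_basis, inner_zero_right, zero_mul, add_zero]
                by_cases hi : i = n
                · subst hi; rw [hn, sub_self, zero_mul]
                · rw [if_neg hi, mul_zero]
            rwa [add_zero] at this
          · rw [innerₛₗ_apply_apply, inner_basis, if_pos rfl]
          · intro i hi
            rw [hreg i hi]
            exact ⟨hφ, hψ⟩
          · intro x y hxy
            rw [innerₛₗ_apply_apply, (perturb_graph_iff hA).mp hxy n, hn, hψ]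
            simp
          · intro x
            rw [innerₛₗ_apply_apply]
            exact ⟨fun h' => h' n hn, fun h' i hi => by rw [hreg i hi, h']⟩
        · exact algMult_of_basis_inner_ne_zero hA hinj hδ h hn hψ hφ hlt hm
      · refine algMult_of_inner_basis_ne_zero hA hinj hδ h hn hψ
          (f := fun j => Nat.casesOn j (-coeff b φ ψ n)
            fun j => taylorCoeff (coeff b φ ψ) (fun i => (lam i : ℂ)) z j)
          rfl (fun j => rfl) ?_ hm
        intro j hj
        rcases j with _ | j
        · simp [hc0 n hn]
        · exact hlt j (by omega)
    · push Not at hz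
      refine ⟨m, ?_, fun _ => rfl, fun h' => (hz _ h'.choose_spec).elim⟩
      refine algMult_of_rank_inf_ker_zero (rank_of_regular hA hδ h ?_ ?_ ?_ hlt hm)
      · exact fun i hi => (hz i hi).elim
      · exact fun x y _ => rfl
      · exact fun x => ⟨fun _ => rfl, fun _ i hi => (hz i hi).elim⟩
  · push Not at hc0
    obtain ⟨n, hn, hcn⟩ := hc0
    refine ⟨0, ?_, fun h' => (h' n hn).elim, fun _ => ?_⟩
    · refine algMult_of_inner_basis_ne_zero hA hinj hδ h hn (right_ne_zero_of_mul hcn)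
        (f := fun j => Nat.casesOn j (-coeff b φ ψ n)
            fun j => taylorCoeff (coeff b φ ψ) (fun i => (lam i : ℂ)) z j)
          rfl (fun j => rfl) (by simp) ?_
      simpa using hcn
    · rw [meromorphicOrderAt_charFun_of_pole hc hinj' hδ h hn hcn]
      simp

end Multiplicity

/-! ### Counting zeros and poles in a disc -/

section Rouche

open MeromorphicOn in
/-- Rouché's theorem for comparison with the constant `1`: if `|F - 1| < 1` on a circle, then
inside the circle `F` has as many zeros as poles, counted with multiplicity. -/
theorem exists_sum_order_eq_zero {F : ℂ → ℂ} {c : ℂ} {R : ℝ} (hR : 0 < R)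
    (hF : MeromorphicOn F (Metric.closedBall c R))
    (htop : ∀ u ∈ Metric.closedBall c R, meromorphicOrderAt F u ≠ ⊤)
    (han : ∀ z ∈ Metric.sphere c R, AnalyticAt ℂ F z)
    (hs : ∀ z ∈ Metric.sphere c R, ‖F z - 1‖ < 1) :
    ∃ s : Finset ℂ, (∀ u ∈ s, u ∈ Metric.ball c R) ∧
      (∀ u ∈ Metric.ball c R, u ∉ s → meromorphicOrderAt F u = 0) ∧
      ∑ u ∈ s, (meromorphicOrderAt F u).untop₀ = 0 := by
  set U := Metric.closedBall c R with hU
  set D := divisor F U with hD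
  have hne : ∀ z ∈ Metric.sphere c R, F z ≠ 0 := by
    intro z hz h0
    have := hs z hz
    rw [h0] at this
    norm_num at this
  have hfin : D.support.Finite := D.finiteSupport (isCompact_closedBall c R)
  have hDs : ∀ z ∈ Metric.sphere c R, D z = 0 := by
    intro z hz
    rw [hD, divisor_apply hF (Metric.sphere_subset_closedBall hz),
      (han z hz).meromorphicOrderAt_eq, (han z hz).analyticOrderAt_eq_zero.mpr (hne z hz)]
    simp
  have hball : ∀ u ∈ hfin.toFinset, u ∈ Metric.ball c R := by
    intro u hu
    have hu' : u ∈ D.support := hfin.mem_toFinset.mp hu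
    have h1 : u ∈ U := D.supportWithinDomain hu'
    rw [hU, ← Metric.ball_union_sphere] at h1
    rcases h1 with h1 | h1
    · exact h1
    · exact (hu' (hDs u h1)).elim
  refine ⟨hfin.toFinset, hball, ?_, ?_⟩
  · intro u hu hus
    have hu' := Metric.ball_subset_closedBall hu
    have h1 : D u = 0 := by simpa using hus
    rw [hD, divisor_apply hF hu'] at h1
    exact (WithTop.untop₀_eq_zero.mp h1).resolve_right (htop u hu')
  · obtain ⟨g, hg, hg0, hFg⟩ := hF.extract_zeros_poles (fun u => htop u u.2) hfin
    have hsne : ∀ z ∈ Metric.sphere c R, ∀ u ∈ hfin.toFinset, z - u ≠ 0 := by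
      intro z hz u hu h0
      have := hball u hu
      rw [← sub_eq_zero.mp h0, Metric.mem_ball, Metric.mem_sphere.mp hz] at this
      exact lt_irrefl _ this
    set P : ℂ → ℂ := fun z => (∏ u ∈ hfin.toFinset, (z - u) ^ D u) * g z with hP
    have hPan : ∀ z ∈ Metric.sphere c R, AnalyticAt ℂ P z := by
      intro z hz
      refine AnalyticAt.mul ?_ (hg z (Metric.sphere_subset_closedBall hz))
      refine Finset.analyticAt_fun_prod _ fun u hu => ?_
      exact AnalyticAt.zpow (by fun_prop) (hsne z hz u hu)
    -- near the circle, `F` equals its factorisation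
    have heq : ∀ z ∈ Metric.sphere c R, F =ᶠ[𝓝 z] P := by
      intro z hz
      have hzU := Metric.sphere_subset_closedBall hz
      refine ((han z hz).frequently_eq_iff_eventually_eq (hPan z hz)).mp ?_
      have hacc : ∃ᶠ w in 𝓝[≠] z, w ∈ U := by
        rw [← accPt_iff_frequently_nhdsNE]
        refine (convex_closedBall c R).isPreconnected.preperfect_of_nontrivial ?_ z hzU
        refine ⟨c, Metric.mem_closedBall_self hR.le, z, hzU, ?_⟩
        rintro rfl
        rw [Metric.mem_sphere, dist_self] at hz
        exact hR.ne hz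
      have h2 := disjoint_principal_right.mp (mem_codiscreteWithin.mp hFg z hzU)
      refine (hacc.and_eventually h2).mono ?_
      rintro w ⟨hw1, hw2⟩
      have h3 : F w = ((∏ᶠ u, (· - u) ^ divisor F U u) • g) w := by
        by_contra h
        exact hw2 ⟨hw1, h⟩
      rw [h3, Pi.smul_apply', smul_eq_mul, Function.FactorizedRational.finprod_eq_fun hfin, hP]
      congr 1
      refine finprod_eq_prod_of_mulSupport_subset _ fun u hu => ?_
      simp only [Finite.coe_toFinset, Function.mem_support]
      intro h0
      exact hu (by simp only [h0, zpow_zero])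
    have hlog : ∀ z ∈ Metric.sphere c R, logDeriv F z =
        (∑ u ∈ hfin.toFinset, (D u : ℂ) * (z - u)⁻¹) + logDeriv g z := by
      intro z hz
      have hgz := hg z (Metric.sphere_subset_closedBall hz)
      rw [(logDeriv_congr_nhds (heq z hz)).eq_of_nhds, hP, logDeriv_mul z
        (Finset.prod_ne_zero_iff.mpr fun u hu => zpow_ne_zero _ (hsne z hz u hu))
        (hg0 ⟨z, Metric.sphere_subset_closedBall hz⟩) ?_ hgz.differentiableAt]
      · congr 1
        rw [logDeriv_prod]
        · refine Finset.sum_congr rfl fun u hu => ?_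
          rw [logDeriv_fun_zpow (by fun_prop)]
          simp [logDeriv_apply]
        · exact fun u hu => zpow_ne_zero _ (hsne z hz u hu)
        · exact fun u hu => DifferentiableAt.zpow (by fun_prop) (Or.inl (hsne z hz u hu))
      · exact DifferentiableAt.fun_finsetProd fun u hu =>
          DifferentiableAt.zpow (by fun_prop) (Or.inl (hsne z hz u hu))
    -- `log F` is a primitive of the logarithmic derivative along the circle
    have hI0 : (∮ z in C(c, R), logDeriv F z) = 0 := by
      refine circleIntegral.integral_eq_zero_of_hasDerivWithinAt (f := fun z => Complex.log (F z))
        hR.le fun z hz => ?_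
      refine ((han z hz).differentiableAt.hasDerivAt.clog ?_).hasDerivWithinAt
      left
      have h1 := (Complex.abs_re_le_norm (F z - 1)).trans_lt (hs z hz)
      rw [Complex.sub_re, Complex.one_re] at h1
      linarith [(abs_lt.mp h1).1]
    have hgan : AnalyticOnNhd ℂ (logDeriv g) U := fun z hz =>
      (hg z hz).deriv.div (hg z hz) (hg0 ⟨z, hz⟩)
    have hIg : (∮ z in C(c, R), logDeriv g z) = 0 :=
      Complex.circleIntegral_eq_zero_of_differentiable_on_off_countable hR.le countable_empty
        hgan.continuousOn fun z hz =>
          (hgan z (Metric.ball_subset_closedBall hz.1)).differentiableAt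
    have hint : ∀ u ∈ hfin.toFinset,
        CircleIntegrable (fun z => (D u : ℂ) * (z - u)⁻¹) c R := by
      intro u hu
      refine ContinuousOn.circleIntegrable hR.le ?_
      exact continuousOn_const.mul (ContinuousOn.inv₀ (by fun_prop) fun z hz => hsne z hz u hu)
    rw [circleIntegral.integral_congr hR.le hlog, circleIntegral.integral_add
      (CircleIntegrable.fun_sum _ hint)
      ((hgan.continuousOn.mono Metric.sphere_subset_closedBall).circleIntegrable hR.le),
      hIg, add_zero, circleIntegral.integral_fun_sum hint] at hI0
    have hu : ∀ u ∈ hfin.toFinset, (∮ z in C(c, R), (D u : ℂ) * (z - u)⁻¹) =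
        (D u : ℂ) * (2 * Real.pi * Complex.I) := by
      intro u hu
      rw [circleIntegral.integral_const_mul, circleIntegral.integral_sub_inv_of_mem_ball (hball u hu)]
    rw [Finset.sum_congr rfl hu, ← Finset.sum_mul] at hI0
    have h3 := (mul_eq_zero.mp hI0).resolve_right Complex.two_pi_I_ne_zero
    have h4 : ∑ u ∈ hfin.toFinset, D u = 0 := by exact_mod_cast h3
    rw [← h4]
    refine Finset.sum_congr rfl fun u hu => ?_
    rw [hD, divisor_apply hF (Metric.ball_subset_closedBall (hball u hu))]

end Rouche

/-! ### Separated families and estimates far out -/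

section Estimates

variable {I : Type*}

/-- A series `∑ c_i / (a_i - z)` is small for large `z` that stay away from the poles, uniformly
when some of the summands are dropped. -/
theorem exists_norm_tsum_div_sub_le {c : I → ℂ} (hc : Summable c) (a : I → ℂ) {δ : ℝ}
    (hδ : 0 < δ) :
    ∃ R₀ : ℝ, ∀ z : ℂ, R₀ ≤ ‖z‖ → ∀ c' : I → ℂ, (∀ i, ‖c' i‖ ≤ ‖c i‖) →
      (∀ i, c' i ≠ 0 → δ ≤ ‖a i - z‖) → ‖∑' i, c' i / (a i - z)‖ ≤ 1 / 2 := by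
  have hbound : ∀ (z : ℂ) (i : I), ‖c i‖ / max δ ‖a i - z‖ ≤ ‖c i‖ / δ := fun z i => by
    gcongr
    exact le_max_left _ _
  have hnn : ∀ (z : ℂ) (i : I), 0 ≤ ‖c i‖ / max δ ‖a i - z‖ := fun z i =>
    div_nonneg (norm_nonneg _) (hδ.le.trans (le_max_left _ _))
  have hlim : Tendsto (fun z : ℂ => ∑' i, ‖c i‖ / max δ ‖a i - z‖) (Bornology.cobounded ℂ)
      (𝓝 (∑' _ : I, (0 : ℝ))) := by
    refine tendsto_tsum_of_dominated_convergence (hc.norm.div_const δ) (fun i => ?_)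
      (Eventually.of_forall fun z i => ?_)
    · refine tendsto_const_nhds.div_atTop (tendsto_atTop_mono (fun z => ?_)
        (tendsto_atTop_add_const_right _ (-‖a i‖) tendsto_norm_cobounded_atTop))
      have := norm_sub_norm_le z (a i)
      rw [norm_sub_rev] at this
      exact le_trans (by linarith) (le_max_right _ _)
    · rw [Real.norm_of_nonneg (hnn z i)]
      exact hbound z i
  rw [tsum_zero] at hlim
  obtain ⟨R₀, -, hR₀⟩ := hasBasis_cobounded_norm.eventually_iff.mp
    (hlim.eventually (gt_mem_nhds (show (0 : ℝ) < 1 / 2 by norm_num)))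
  refine ⟨R₀, fun z hz c' hc' hsep => le_trans ?_ (hR₀ (show z ∈ {z | R₀ ≤ ‖z‖} from hz)).le⟩
  refine tsum_of_norm_bounded
    (Summable.of_nonneg_of_le (hnn z) (hbound z) (hc.norm.div_const δ)).hasSum fun i => ?_
  rw [norm_div]
  by_cases hi : c' i = 0
  · rw [hi, norm_zero, zero_div]
    exact hnn z i
  · have h1 := hsep i hi
    rw [max_eq_right h1]
    gcongr
    exact hc' i

section Separated

variable {lam : I → ℝ} {d : ℝ}

theorem injective_of_separated (hd : 0 < d) (hsep : ∀ m n, m ≠ n → d ≤ |lam m - lam n|) :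
    Function.Injective lam := by
  intro m n h
  by_contra hne
  have := hsep m n hne
  rw [h, sub_self, abs_zero] at this
  linarith

/-- There are arbitrarily large circles about the origin which keep a fixed distance from a
separated real family. -/
theorem exists_radius_of_separated (hd : 0 < d) (hsep : ∀ m n, m ≠ n → d ≤ |lam m - lam n|)
    (X : ℝ) : ∃ R, X ≤ R ∧ 0 < R ∧ ∀ n, d / 8 ≤ |(|lam n| - R)| := by
  have hlt : ∀ m n, lam m < lam n → lam n < lam m + d → False := by
    intro m n h1 h2
    have := hsep n m (by rintro rfl; exact lt_irrefl _ h1)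
    rw [abs_of_pos (by linarith)] at this
    linarith
  by_contra! hcon
  set Y := max X d
  have hY : d ≤ Y := le_max_right _ _
  have hX : X ≤ Y := le_max_left _ _
  -- of three equidistant radii, each of the two half-lines can spoil only one
  obtain ⟨i, hi⟩ := hcon Y hX (by linarith)
  obtain ⟨j, hj⟩ := hcon (Y + d / 3) (by linarith) (by linarith)
  obtain ⟨k, hk⟩ := hcon (Y + 2 * d / 3) (by linarith) (by linarith)
  rw [abs_lt] at hi hj hk
  rcases abs_cases (lam i) with ⟨ei, _⟩ | ⟨ei, _⟩ <;>
  rcases abs_cases (lam j) with ⟨ej, _⟩ | ⟨ej, _⟩ <;>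
  rcases abs_cases (lam k) with ⟨ek, _⟩ | ⟨ek, _⟩ <;>
  rw [ei] at hi <;> rw [ej] at hj <;> rw [ek] at hk <;>
  first
  | exact hlt i j (by linarith) (by linarith)
  | exact hlt j i (by linarith) (by linarith)
  | exact hlt i k (by linarith) (by linarith)
  | exact hlt k i (by linarith) (by linarith)
  | exact hlt j k (by linarith) (by linarith)
  | exact hlt k j (by linarith) (by linarith)

theorem finite_abs_lt_of_separated (hd : 0 < d) (hsep : ∀ m n, m ≠ n → d ≤ |lam m - lam n|)
    (R : ℝ) : {n | |lam n| < R}.Finite := by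
  refine Finite.of_finite_image (f := fun n => ⌊lam n / d⌋) ?_ ?_
  · refine (finite_Icc ⌊-R / d⌋ ⌊R / d⌋).subset ?_
    rintro _ ⟨n, hn, rfl⟩
    have hn := abs_lt.mp (show |lam n| < R from hn)
    constructor
    · exact Int.floor_le_floor (by gcongr; exact hn.1.le)
    · exact Int.floor_le_floor (by gcongr; exact hn.2.le)
  · intro m _ n _ h
    by_contra hne
    have h1 := Int.abs_sub_lt_one_of_floor_eq_floor h
    rw [← sub_div, abs_div, abs_of_pos hd, div_lt_one hd] at h1
    exact (hsep m n hne).not_gt h1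

theorem exists_gap_of_separated (hd : 0 < d) (hsep : ∀ m n, m ≠ n → d ≤ |lam m - lam n|) (z : ℂ) :
    ∃ δ > 0, ∀ i, (lam i : ℂ) ≠ z → δ ≤ ‖(lam i : ℂ) - z‖ := by
  by_cases h : ∃ n, (lam n : ℂ) ≠ z ∧ ‖(lam n : ℂ) - z‖ < d / 2
  · obtain ⟨n, hn, hn'⟩ := h
    refine ⟨‖(lam n : ℂ) - z‖, norm_pos_iff.mpr (sub_ne_zero.mpr hn), fun i hi => ?_⟩
    by_cases hin : i = n
    · rw [hin]
    · have h1 := hsep i n hin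
      have h2 := norm_sub_le ((lam i : ℂ) - z) ((lam n : ℂ) - z)
      rw [sub_sub_sub_cancel_right, ← Complex.ofReal_sub, Complex.norm_real, Real.norm_eq_abs] at h2
      linarith
  · push Not at h
    exact ⟨d / 2, by positivity, h⟩

end Separated

/-- `charFun` vanishes identically near no point, since it is close to `1` far from the real axis. -/
theorem meromorphicOrderAt_charFun_ne_top {c : I → ℂ} (hc : Summable c) {lam : I → ℝ}
    {d : ℝ} (hd : 0 < d) (hsep : ∀ m n, m ≠ n → d ≤ |lam m - lam n|) (z : ℂ) :
    meromorphicOrderAt (charFun c fun i => (lam i : ℂ)) z ≠ ⊤ := by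
  have ha : Function.Injective fun i => (lam i : ℂ) :=
    Complex.ofReal_injective.comp (injective_of_separated hd hsep)
  have hmer : ∀ w, MeromorphicAt (charFun c fun i => (lam i : ℂ)) w := fun w => by
    obtain ⟨δ, hδ, h⟩ := exists_gap_of_separated hd hsep w
    exact meromorphicAt_charFun hc ha hδ h
  obtain ⟨R₀, hR₀⟩ := exists_norm_tsum_div_sub_le hc (fun i => (lam i : ℂ)) one_pos
  set y : ℝ := max R₀ 1 + 1
  -- `charFun` has no zeros high up in the upper half-plane
  have hy : meromorphicOrderAt (charFun c fun i => (lam i : ℂ)) (y * Complex.I) ≠ ⊤ := by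
    rw [meromorphicOrderAt_ne_top_iff_eventually_ne_zero (hmer _)]
    have hopen : IsOpen {w : ℂ | max R₀ 1 < w.im} := isOpen_lt continuous_const Complex.continuous_im
    filter_upwards [mem_nhdsWithin_of_mem_nhds
      (hopen.mem_nhds (show max R₀ 1 < (y * Complex.I).im by simp [y]))] with w hw h0
    have hw : max R₀ 1 < w.im := hw
    have h1 := hR₀ w (((le_max_left _ _).trans hw.le).trans
      ((le_abs_self _).trans (Complex.abs_im_le_norm w))) c (fun _ => le_rfl) fun i _ => by
        have := Complex.abs_im_le_norm ((lam i : ℂ) - w)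
        rw [Complex.sub_im, Complex.ofReal_im, zero_sub, abs_neg] at this
        exact (((le_max_right _ _).trans hw.le).trans (le_abs_self _)).trans this
    have h2 : ∑' i, c i / ((lam i : ℂ) - w) = -1 := by
      rw [charFun] at h0; linear_combination h0
    rw [h2] at h1
    norm_num at h1
  exact MeromorphicOn.meromorphicOrderAt_ne_top_of_isPreconnected (U := univ)
    (fun w _ => hmer w) isPreconnected_univ (mem_univ _) (mem_univ z) hy

end Estimates

/-! ### Labelling the eigenvalues -/

section Labelling

theorem exists_eq_one_of_sum_eq_one {α : Type*} {s : Finset α} {m : α → ℕ}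
    (h : ∑ u ∈ s, m u = 1) : ∃ u ∈ s, m u = 1 ∧ ∀ v ∈ s, v ≠ u → m v = 0 := by
  classical
  obtain ⟨u, hu, hu0⟩ := Finset.exists_ne_zero_of_sum_ne_zero (h.trans_ne one_ne_zero)
  have h1 := Finset.add_sum_erase s m hu
  have h2 : ∑ v ∈ s.erase u, m v = 0 := by omega
  refine ⟨u, hu, by omega, fun v hv hvu => ?_⟩
  exact Finset.sum_eq_zero_iff.mp h2 v (Finset.mem_erase.mpr ⟨hvu, hv⟩)

/-- Finitely many indices can be distributed on finitely many points with prescribed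
multiplicities of the right total. -/
theorem exists_labelling {I α : Type*} {N : Finset I} {Z : Finset α} {m : α → ℕ}
    (h : ∑ u ∈ Z, m u = N.card) :
    ∃ μ : N → α, (∀ i, μ i ∈ Z) ∧ ∀ z ∈ Z, {i : I | ∃ h : i ∈ N, μ ⟨i, h⟩ = z}.encard = m z := by
  have hcard : Fintype.card N = Fintype.card (Σ u : Z, Fin (m u)) := by
    rw [Fintype.card_coe, Fintype.card_sigma, ← h, ← Finset.sum_coe_sort]
    simp
  let e : N ≃ Σ u : Z, Fin (m u) := Fintype.equivOfCardEq hcard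
  refine ⟨fun i => (e i).1, fun i => (e i).1.2, fun z hz => ?_⟩
  have hset : {i : I | ∃ h : i ∈ N, ((e ⟨i, h⟩).1 : α) = z} =
      range fun k : Fin (m z) => ((e.symm ⟨⟨z, hz⟩, k⟩ : N) : I) := by
    ext i
    constructor
    · rintro ⟨hi, rfl⟩
      exact ⟨(e ⟨i, hi⟩).2, by simp⟩
    · rintro ⟨k, rfl⟩
      exact ⟨(e.symm ⟨⟨z, hz⟩, k⟩).2, by simp⟩
  have hinj : Function.Injective fun k : Fin (m z) => ((e.symm ⟨⟨z, hz⟩, k⟩ : N) : I) := by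
    intro k k' hk
    have := e.symm.injective (Subtype.ext hk)
    simpa using this
  rw [hset, ← image_univ, hinj.encard_image, encard_univ]
  simp

variable {I : Type*} {c : I → ℂ} {lam : I → ℝ} {d : ℝ} {m : ℂ → ℕ}

/-- In a disc on whose boundary `charFun` is close to `1`, the total multiplicity equals the number
of poles. -/
theorem exists_sum_mult_eq_card (hc : Summable c) (hd : 0 < d)
    (hsep : ∀ m n, m ≠ n → d ≤ |lam m - lam n|)
    (hm1 : ∀ z, (∀ n, (lam n : ℂ) ≠ z) →
      meromorphicOrderAt (charFun c fun i => (lam i : ℂ)) z = (m z : ℤ))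
    (hm2 : ∀ z, (∃ n, (lam n : ℂ) = z) →
      meromorphicOrderAt (charFun c fun i => (lam i : ℂ)) z = ((m z - 1 : ℤ) : ℤ))
    {z₀ : ℂ} {ρ δ : ℝ} (hρ : 0 < ρ) (hδ : 0 < δ)
    (hclose : ∀ z ∈ Metric.sphere z₀ ρ, ‖∑' i, c i / ((lam i : ℂ) - z)‖ ≤ 1 / 2)
    (haway : ∀ z ∈ Metric.sphere z₀ ρ, ∀ i, δ ≤ ‖(lam i : ℂ) - z‖)
    {N : Finset I} (hN : ∀ i, i ∈ N ↔ (lam i : ℂ) ∈ Metric.ball z₀ ρ) :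
    ∃ Z : Finset ℂ, (∀ u ∈ Z, u ∈ Metric.ball z₀ ρ) ∧ (∀ u ∈ Metric.ball z₀ ρ, u ∉ Z → m u = 0) ∧
      ∑ u ∈ Z, m u = N.card := by
  classical
  have ha : Function.Injective fun i => (lam i : ℂ) :=
    Complex.ofReal_injective.comp (injective_of_separated hd hsep)
  set F := charFun c fun i => (lam i : ℂ) with hF
  obtain ⟨s, hs1, hs2, hs3⟩ := exists_sum_order_eq_zero (F := F) hρ
    (fun w _ => by
      obtain ⟨δ', hδ', h⟩ := exists_gap_of_separated hd hsep w
      exact meromorphicAt_charFun hc ha hδ' h)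
    (fun w _ => meromorphicOrderAt_charFun_ne_top hc hd hsep w)
    (fun z hz => analyticAt_const.add
      (analyticAt_tsum_div_sub hc hδ fun i _ => haway z hz i))
    (fun z hz => by
      rw [hF, charFun, add_sub_cancel_left]
      exact (hclose z hz).trans_lt (by norm_num))
  set P : Finset ℂ := N.image fun i => (lam i : ℂ) with hP
  have hPball : ∀ u ∈ P, u ∈ Metric.ball z₀ ρ := by
    intro u hu
    obtain ⟨i, hi, rfl⟩ := Finset.mem_image.mp hu
    exact (hN i).mp hi
  have hm : ∀ u ∈ Metric.ball z₀ ρ,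
      (meromorphicOrderAt F u).untop₀ = (m u : ℤ) - if u ∈ P then 1 else 0 := by
    intro u hu
    by_cases h : ∃ n, (lam n : ℂ) = u
    · have : u ∈ P := by
        obtain ⟨n, rfl⟩ := h
        exact Finset.mem_image_of_mem _ ((hN n).mpr hu)
      rw [hm2 u h, if_pos this, WithTop.untop₀_coe]
    · have : u ∉ P := fun hu' => by
        obtain ⟨i, _, hi⟩ := Finset.mem_image.mp hu'
        exact h ⟨i, hi⟩
      rw [hm1 u (not_exists.mp h), if_neg this, WithTop.untop₀_coe, sub_zero]
  refine ⟨s ∪ P, ?_, ?_, ?_⟩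
  · intro u hu
    rcases Finset.mem_union.mp hu with h | h
    exacts [hs1 u h, hPball u h]
  · intro u hu hus
    rw [Finset.mem_union, not_or] at hus
    have h1 := hm u hu
    rw [hs2 u hu hus.1, if_neg hus.2] at h1
    simpa using h1.symm
  · have h1 : ∑ u ∈ s ∪ P, (meromorphicOrderAt F u).untop₀ = 0 := by
      rw [← hs3]
      refine (Finset.sum_subset Finset.subset_union_left fun u hu hus => ?_).symm
      rw [hs2 u (hPball u ((Finset.mem_union.mp hu).resolve_left hus)) hus]
      rfl
    have h2 : ∀ u ∈ s ∪ P, (meromorphicOrderAt F u).untop₀ = (m u : ℤ) - if u ∈ P then 1 else 0 := by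
      intro u hu
      refine hm u ?_
      rcases Finset.mem_union.mp hu with h | h
      exacts [hs1 u h, hPball u h]
    rw [Finset.sum_congr rfl h2, Finset.sum_sub_distrib, Finset.sum_ite_mem,
      Finset.union_inter_cancel_right, Finset.sum_const, hP, Finset.card_image_of_injective _ ha,
      sub_eq_zero] at h1
    have : ((∑ u ∈ s ∪ P, m u : ℕ) : ℤ) = (N.card : ℤ) := by
      push_cast
      simpa using h1
    exact_mod_cast this

/-- A zero of `charFun` near a pole `lam n` far out is as close to it as the coefficient `c n`. -/
theorem norm_sub_le_of_charFun_eq_zero {n : I} {z : ℂ} {δ : ℝ} (hc : Summable c) (hδ : 0 < δ)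
    (hz : (lam n : ℂ) ≠ z) (hfar : ∀ i, i ≠ n → δ ≤ ‖(lam i : ℂ) - z‖)
    (hsmall : ∀ c' : I → ℂ, (∀ i, ‖c' i‖ ≤ ‖c i‖) →
      (∀ i, c' i ≠ 0 → δ ≤ ‖(lam i : ℂ) - z‖) → ‖∑' i, c' i / ((lam i : ℂ) - z)‖ ≤ 1 / 2)
    (h0 : charFun c (fun i => (lam i : ℂ)) z = 0) : ‖z - lam n‖ ≤ 2 * ‖c n‖ := by
  classical
  have hpos : 0 < ‖(lam n : ℂ) - z‖ := norm_pos_iff.mpr (sub_ne_zero.mpr hz)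
  have hs : Summable fun i => c i / ((lam i : ℂ) - z) := by
    refine summable_div_sub hc (δ := min δ ‖(lam n : ℂ) - z‖) (lt_min hδ hpos) fun i _ => ?_
    by_cases hi : i = n
    · rw [hi]; exact min_le_right _ _
    · exact (min_le_left _ _).trans (hfar i hi)
  have h1 := hsmall (fun i => if i = n then 0 else c i)
    (fun i => by split_ifs <;> simp) fun i hi => hfar i fun h => hi (if_pos h)
  have h2 : ∀ i, (if i = n then 0 else c i) / ((lam i : ℂ) - z) =
      if i = n then 0 else c i / ((lam i : ℂ) - z) := fun i => by split_ifs <;> simp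
  simp only [h2] at h1
  rw [charFun, hs.tsum_eq_add_tsum_ite n] at h0
  have h3 : c n / ((lam n : ℂ) - z) =
      -1 - ∑' i, if i = n then 0 else c i / ((lam i : ℂ) - z) := by linear_combination h0
  have h4 := norm_sub_norm_le (-1 : ℂ) (∑' i, if i = n then 0 else c i / ((lam i : ℂ) - z))
  rw [← h3, norm_div, norm_neg, norm_one, le_div_iff₀ hpos] at h4
  rw [norm_sub_rev]
  nlinarith

/-- If the multiplicities `m` are the orders of `charFun`, raised by one at the poles, then the
points can be labelled by the poles with summable distances, and all but finitely many of
them have multiplicity one. -/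
theorem exists_labelling_summable (hc : Summable c) (hd : 0 < d)
    (hsep : ∀ m n, m ≠ n → d ≤ |lam m - lam n|)
    (hm1 : ∀ z, (∀ n, (lam n : ℂ) ≠ z) →
      meromorphicOrderAt (charFun c fun i => (lam i : ℂ)) z = (m z : ℤ))
    (hm2 : ∀ z, (∃ n, (lam n : ℂ) = z) →
      meromorphicOrderAt (charFun c fun i => (lam i : ℂ)) z = ((m z - 1 : ℤ) : ℤ)) :
    (∃ μ : I → ℂ, (∀ z, {n | μ n = z}.encard = m z) ∧ Summable fun n => ‖μ n - (lam n : ℂ)‖) ∧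
      {z | m z ≠ 0 ∧ m z ≠ 1}.Finite := by
  classical
  set r : ℝ := d / 8 with hr
  have hr0 : 0 < r := by positivity
  obtain ⟨R₀, hR₀⟩ := exists_norm_tsum_div_sub_le hc (fun i => (lam i : ℂ)) hr0
  obtain ⟨R, hRR, hRpos, hRsep⟩ := exists_radius_of_separated hd hsep R₀
  set N : Finset I := (finite_abs_lt_of_separated hd hsep R).toFinset with hN
  have hNmem : ∀ i, i ∈ N ↔ |lam i| < R := fun i => by simp [hN]
  have hnorm : ∀ i, ‖(lam i : ℂ)‖ = |lam i| := fun i => by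
    rw [Complex.norm_real, Real.norm_eq_abs]
  have hin : ∀ i, i ∈ N → |lam i| ≤ R - r := fun i hi => by
    have h1 := hRsep i
    rw [abs_of_neg (sub_neg.mpr ((hNmem i).mp hi))] at h1
    linarith
  have hout : ∀ i, i ∉ N → R + r ≤ |lam i| := fun i hi => by
    have h1 := hRsep i
    rw [hNmem, not_lt] at hi
    rw [abs_of_nonneg (sub_nonneg.mpr hi)] at h1
    linarith
  -- outside the big disc and the small discs around the remaining poles
  have haway : ∀ z : ℂ, R ≤ ‖z‖ → (∀ i, i ∉ N → r ≤ ‖(lam i : ℂ) - z‖) →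
      ∀ i, r ≤ ‖(lam i : ℂ) - z‖ := by
    intro z hz h i
    by_cases hi : i ∈ N
    · have h1 := hin i hi
      have h2 := norm_sub_norm_le z (lam i)
      rw [norm_sub_rev, hnorm] at h2
      linarith
    · exact h i hi
  have hsmall : ∀ z : ℂ, R ≤ ‖z‖ → (∀ i, r ≤ ‖(lam i : ℂ) - z‖) →
      ‖∑' i, c i / ((lam i : ℂ) - z)‖ ≤ 1 / 2 := fun z hz h =>
    hR₀ z (hRR.trans hz) c (fun _ => le_rfl) fun i _ => h i
  have hfar : ∀ n z, ‖z - (lam n : ℂ)‖ ≤ r → ∀ i, i ≠ n → r ≤ ‖(lam i : ℂ) - z‖ := by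
    intro n z hz i hi
    have h1 := hsep i n hi
    have h2 := norm_add_le ((lam i : ℂ) - z) (z - (lam n : ℂ))
    rw [sub_add_sub_cancel, ← Complex.ofReal_sub, Complex.norm_real, Real.norm_eq_abs] at h2
    linarith
  have hnear : ∀ n, n ∉ N → ∀ z, ‖z - (lam n : ℂ)‖ ≤ r → R ≤ ‖z‖ := by
    intro n hn z hz
    have h1 := hout n hn
    have h2 := norm_sub_norm_le (lam n : ℂ) z
    rw [norm_sub_rev, hnorm] at h2
    linarith
  -- the big disc
  obtain ⟨Z, hZball, hZ0, hZsum⟩ := exists_sum_mult_eq_card (z₀ := 0) (N := N) hc hd hsep hm1 hm2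
    hRpos hr0
    (fun z hz => by
      have hz : ‖z‖ = R := by simpa using hz
      refine hsmall z hz.ge (haway z hz.ge fun i hi => ?_)
      have h2 := norm_sub_norm_le (lam i : ℂ) z
      rw [hnorm] at h2
      linarith [hout i hi])
    (fun z hz => by
      have hz : ‖z‖ = R := by simpa using hz
      refine haway z hz.ge fun i hi => ?_
      have h2 := norm_sub_norm_le (lam i : ℂ) z
      rw [hnorm] at h2
      linarith [hout i hi])
    (fun i => by rw [hNmem, mem_ball_zero_iff, hnorm])
  obtain ⟨μ₀, hμ₀Z, hμ₀⟩ := exists_labelling hZsum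
  -- the small discs
  have hdisc : ∀ n, n ∉ N → ∃ ν ∈ Metric.ball (lam n : ℂ) r, m ν = 1 ∧
      ∀ u ∈ Metric.ball (lam n : ℂ) r, u ≠ ν → m u = 0 := by
    intro n hn
    have hsph : ∀ z ∈ Metric.sphere (lam n : ℂ) r, ∀ i, r ≤ ‖(lam i : ℂ) - z‖ := by
      intro z hz i
      rw [Metric.mem_sphere, dist_eq_norm] at hz
      by_cases hi : i = n
      · rw [hi, norm_sub_rev, hz]
      · exact hfar n z hz.le i hi
    obtain ⟨Zn, h1, h2, h3⟩ := exists_sum_mult_eq_card (z₀ := (lam n : ℂ)) (N := {n})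
      hc hd hsep hm1 hm2 hr0 hr0
      (fun z hz => hsmall z
        (hnear n hn z (by rw [← dist_eq_norm]; exact (Metric.mem_sphere.mp hz).le)) (hsph z hz))
      hsph
      (fun i => by
        rw [Finset.mem_singleton, Metric.mem_ball]
        constructor
        · rintro rfl; rwa [dist_self]
        · intro hi
          by_contra hne
          have h4 := hsep i n hne
          rw [dist_eq_norm, ← Complex.ofReal_sub, Complex.norm_real, Real.norm_eq_abs] at hi
          linarith)
    obtain ⟨ν, hν, hν1, hν2⟩ := exists_eq_one_of_sum_eq_one (by simpa using h3)
    refine ⟨ν, h1 ν hν, hν1, fun u hu huν => ?_⟩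
    by_cases hu' : u ∈ Zn
    · exact hν2 u hu' huν
    · exact h2 u hu hu'
  choose! ν hνball hν1 hν0 using hdisc
  have hνR : ∀ n, n ∉ N → R ≤ ‖ν n‖ := fun n hn =>
    hnear n hn _ (by rw [← dist_eq_norm]; exact (Metric.mem_ball.mp (hνball n hn)).le)
  have huniq : ∀ z n n', z ∈ Metric.ball (lam n : ℂ) r → z ∈ Metric.ball (lam n' : ℂ) r →
      n = n' := by
    intro z n n' h1 h2
    by_contra hne
    have h3 := hfar n' z (by rw [← dist_eq_norm]; exact (Metric.mem_ball.mp h2).le) n hne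
    rw [Metric.mem_ball, dist_eq_norm, norm_sub_rev] at h1
    linarith
  have hrest : ∀ z : ℂ, R ≤ ‖z‖ → (∀ n, n ∉ N → z ∉ Metric.ball (lam n : ℂ) r) → m z = 0 := by
    intro z hz hz'
    have h1 := haway z hz fun i hi => by
      have := hz' i hi
      rwa [Metric.mem_ball, not_lt, dist_eq_norm, norm_sub_rev] at this
    have h2 := hm1 z fun n hn => by
      have := h1 n
      rw [hn, sub_self, norm_zero] at this
      linarith
    have han : AnalyticAt ℂ (charFun c fun i => (lam i : ℂ)) z :=
      analyticAt_const.add (analyticAt_tsum_div_sub hc hr0 fun i _ => h1 i)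
    have hne : charFun c (fun i => (lam i : ℂ)) z ≠ 0 := by
      intro h0
      have h3 := hsmall z hz h1
      have h4 : ∑' i, c i / ((lam i : ℂ) - z) = -1 := by
        rw [charFun] at h0; linear_combination h0
      rw [h4] at h3
      norm_num at h3
    rw [han.meromorphicOrderAt_eq, han.analyticOrderAt_eq_zero.mpr hne] at h2
    have h5 : (((m z : ℤ)) : WithTop ℤ) = ((0 : ℤ) : WithTop ℤ) := by rw [← h2]; rfl
    exact_mod_cast h5
  let μ : I → ℂ := fun i => if h : i ∈ N then μ₀ ⟨i, h⟩ else ν i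
  have hμin : ∀ i (h : i ∈ N), μ i = μ₀ ⟨i, h⟩ := fun i h => dif_pos h
  have hμout : ∀ i, i ∉ N → μ i = ν i := fun i h => dif_neg h
  have hμ₀R : ∀ i, ‖μ₀ i‖ < R := fun i => by simpa using hZball _ (hμ₀Z i)
  refine ⟨⟨μ, fun z => ?_, ?_⟩, ?_⟩
  · by_cases hz : ‖z‖ < R
    · have hset : {n | μ n = z} = {i : I | ∃ h : i ∈ N, μ₀ ⟨i, h⟩ = z} := by
        ext i
        constructor
        · intro hi
          have hi : μ i = z := hi
          by_cases h : i ∈ N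
          · exact ⟨h, by rw [← hμin i h, hi]⟩
          · rw [hμout i h] at hi
            have := hνR i h
            rw [hi] at this
            exact absurd hz this.not_gt
        · rintro ⟨h, hi⟩
          exact (hμin i h).trans hi
      rw [hset]
      by_cases hzZ : z ∈ Z
      · exact hμ₀ z hzZ
      · rw [hZ0 z (by simpa using hz) hzZ, Nat.cast_zero, encard_eq_zero, eq_empty_iff_forall_notMem]
        rintro i ⟨h, rfl⟩
        exact hzZ (hμ₀Z _)
    · rw [not_lt] at hz
      have hzN : ∀ i, μ i = z → i ∉ N := by
        intro i hi h
        rw [hμin i h] at hi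
        have := hμ₀R ⟨i, h⟩
        rw [hi] at this
        linarith
      have hzball : ∀ i, μ i = z → z ∈ Metric.ball (lam i : ℂ) r := by
        intro i hi
        have h := hzN i hi
        rw [hμout i h] at hi
        rw [← hi]
        exact hνball i h
      by_cases hex : ∃ n, n ∉ N ∧ z ∈ Metric.ball (lam n : ℂ) r
      · obtain ⟨n, hn, hzn⟩ := hex
        by_cases hzν : z = ν n
        · have hset : {i | μ i = z} = {n} := by
            ext i
            constructor
            · exact fun hi => huniq z i n (hzball i hi) hzn
            · rintro rfl
              exact (hμout i hn).trans hzν.symm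
          rw [hset, encard_singleton, hzν, hν1 n hn, Nat.cast_one]
        · rw [hν0 n hn z hzn hzν, Nat.cast_zero, encard_eq_zero, eq_empty_iff_forall_notMem]
          intro i hi
          have hin' := huniq z i n (hzball i hi) hzn
          subst hin'
          exact hzν (hi.symm.trans (hμout i hn))
      · push Not at hex
        rw [hrest z hz hex, Nat.cast_zero, encard_eq_zero, eq_empty_iff_forall_notMem]
        exact fun i hi => hex i (hzN i hi) (hzball i hi)
  · refine Summable.of_norm_bounded_eventually (hc.norm.mul_left 2) ?_
    filter_upwards [N.finite_toSet.compl_mem_cofinite] with n hn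
    have hn : n ∉ N := hn
    rw [norm_norm, hμout n hn]
    by_cases hne : (lam n : ℂ) = ν n
    · rw [← hne, sub_self, norm_zero]; positivity
    · have hball := hνball n hn
      have hle : ‖ν n - lam n‖ ≤ r := by rw [← dist_eq_norm]; exact (Metric.mem_ball.mp hball).le
      refine norm_sub_le_of_charFun_eq_zero hc hr0 hne (hfar n _ hle)
        (hR₀ _ (hRR.trans (hνR n hn))) ?_
      have h1 := hm1 (ν n) fun i hi => by
        by_cases hin' : i = n
        · exact hne (hin' ▸ hi)
        · have := hfar n _ hle i hin'
          rw [hi, sub_self, norm_zero] at this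
          linarith
      have hpos : 0 < ‖(lam n : ℂ) - ν n‖ := norm_pos_iff.mpr (sub_ne_zero.mpr hne)
      have han : AnalyticAt ℂ (charFun c fun i => (lam i : ℂ)) (ν n) := by
        refine analyticAt_const.add (analyticAt_tsum_div_sub hc (lt_min hr0 hpos) fun i _ => ?_)
        by_cases hi : i = n
        · rw [hi]; exact min_le_right _ _
        · exact (min_le_left _ _).trans (hfar n _ hle i hi)
      by_contra h0
      rw [han.meromorphicOrderAt_eq, han.analyticOrderAt_eq_zero.mpr h0, hν1 n hn] at h1
      have h5 : ((1 : ℤ) : WithTop ℤ) = ((0 : ℤ) : WithTop ℤ) := by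
        rw [← Nat.cast_one (R := ℤ), ← h1]; rfl
      exact one_ne_zero (WithTop.coe_injective h5)
  · refine Z.finite_toSet.subset ?_
    rintro z ⟨hz0, hz1⟩
    by_cases hz : ‖z‖ < R
    · by_contra hzZ
      exact hz0 (hZ0 z (by simpa using hz) hzZ)
    · exfalso
      rw [not_lt] at hz
      by_cases hex : ∃ n, n ∉ N ∧ z ∈ Metric.ball (lam n : ℂ) r
      · obtain ⟨n, hn, hzn⟩ := hex
        by_cases hzν : z = ν n
        · exact hz1 (hzν ▸ hν1 n hn)
        · exact hz0 (hν0 n hn z hzn hzν)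
      · push Not at hex
        exact hz0 (hrest z hz hex)

end Labelling

theorem algMult_ne_zero_of_isEigenvalue {H : Type*} [NormedAddCommGroup H] [InnerProductSpace ℂ H]
    {T : H →ₗ.[ℂ] H} {z : ℂ} (h : IsEigenvalue T z) : algMult T z ≠ 0 := by
  intro h0
  rw [algMult, Cardinal.toENat_eq_zero, Submodule.rank_eq_zero] at h0
  exact h (eq_bot_iff.mpr (h0 ▸ le_iSup (kerPow T z) 1))

end RankOnePert

theorem theorem3p1 {H : Type*} [NormedAddCommGroup H] [InnerProductSpace ℂ H] [CompleteSpace H]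
    (A : H →ₗ.[ℂ] H) (hA : IsSelfAdjoint A) (hdisc : RankOnePert.HasSimpleDiscreteSpectrum A)
    {I : Type*} (lam : I → ℝ)
    (hlam : Set.range (fun n => (lam n : ℂ)) = RankOnePert.opSpectrum A)
    (d : ℝ) (hd : 0 < d) (hsep : ∀ m n, m ≠ n → d ≤ |lam m - lam n|)
    (φ ψ : H) :
    (∃ μ : I → ℂ,
      (∀ z : ℂ, {n | μ n = z}.encard =
        RankOnePert.algMult (RankOnePert.perturb A φ ψ) z) ∧
      Summable fun n => ‖μ n - (lam n : ℂ)‖) ∧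
    {z : ℂ | RankOnePert.IsEigenvalue (RankOnePert.perturb A φ ψ) z ∧
      RankOnePert.algMult (RankOnePert.perturb A φ ψ) z ≠ 1}.Finite := by
  have hinj := RankOnePert.injective_of_separated hd hsep
  obtain ⟨b, hb⟩ := RankOnePert.exists_isDiagonal hA hdisc hlam hd hsep
  have hc := RankOnePert.summable_coeff b φ ψ
  choose δ hδ hgap using RankOnePert.exists_gap_of_separated hd hsep
  have hmult := fun z => RankOnePert.exists_algMult_eq (φ := φ) (ψ := ψ) hb hinj (hδ z) (hgap z)
    (RankOnePert.meromorphicOrderAt_charFun_ne_top hc hd hsep z)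
  choose m hm hm1 hm2 using hmult
  obtain ⟨⟨μ, hμ, hsum⟩, hfin⟩ :=
    RankOnePert.exists_labelling_summable hc hd hsep hm1 hm2
  refine ⟨⟨μ, fun z => (hμ z).trans (hm z).symm, hsum⟩, hfin.subset ?_⟩
  rintro z ⟨hz, hz1⟩
  have hz0 := RankOnePert.algMult_ne_zero_of_isEigenvalue hz
  rw [hm z] at hz0 hz1
  exact ⟨by exact_mod_cast hz0, by exact_mod_cast hz1⟩
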